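/- **Setting.** For integers $0\le m\le q$, $0\le n\le p$ and parameters $a_i,b_j\in\mathbb C$, $A_i,\alpha_i>0$ $(1\le i\le p)$, $B_j,\beta_j>0$ $(1\le j\le q)$, put $$\chi(s)=\frac{\prod_{j=1}^{m}\Gamma^{\beta_j}(b_j+B_js)\,\prod_{i=1}^{n}\Gamma^{\alpha_i}(1-a_i-A_is)}{\prod_{j=m+1}^{q}\Gamma^{\beta_j}(1-b_j-B_js)\,\prod_{i=n+1}^{p}\Gamma^{\alpha_i}(a_i+A_is)},$$ where $\Gamma^{\kappa}(w)=\exp(\kappa\log\Gamma(w))$ with $\log\Gamma$ the branch that is analytic on $\mathbb C\setminus(-\infty,0]$ and real on $(0,\infty)$, extended to the cut by continuity from above (at the poles of $\Gamma$, put $1/\Gamma^\kappa=0$). For $z\ne0$ the $I$-function is $$I^{m,n}_{p,q}\Big[z\,\Big|{(a_i,A_i,\alpha_i)_{1,p}\atop (b_j,B_j,\beta_j)_{1,q}}\Big]=\frac1{2\pi i}\int_{-i\infty}^{i\infty}\chi(s)\,z^{-s}\,ds ,$$ taken along the imaginary axis, with the principal value of $z^{-s}$. It is called admissible at $z$ if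 all singularities of the factors $\Gamma^{\beta_j}(b_j+B_js)$, $j\le m$, have $\operatorname{Re}(s)<0$, all singularities of the factors $\Gamma^{\alpha_i}(1-a_i-A_is)$, $i\le n$, have $\operatorname{Re}(s)>0$, and the integral converges absolutely. For $\alpha,\alpha',\beta,\beta',\gamma\in\mathbb C$ with $\operatorname{Re}(\gamma)>0$ and $x>0$, the right-sided Marichev–Saigo–Maeda integral is $$\big(\mathcal I_-^{\alpha,\alpha',\beta,\beta',\gamma}f\big)(x)=\frac{x^{-\alpha'}}{\Gamma(\gamma)}\int_x^\infty (t-x)^{\gamma-1}t^{-\alpha}F_3\Big(\alpha,\alpha',\beta,\beta';\gamma;1-\frac xt,1-\frac tx\Big)f(t)\,dt,$$ where $F_3$ is the third Appell function, i.e. $F_3(\alpha,\alpha',\beta,\beta';\gamma;u,v)=\sum_{k,l\ge0}\frac{(\alpha)_k(\alpha')_l(\beta)_k(\beta')_l}{(\gamma)_{k+l}}\frac{u^kv^l}{k!\,l!}$ for $|u|,|v|<1$, and for $|u|<1$ and $v\le -1$ its analytic continuation in $v$ from the unit disc to the union of the unit disc and the half plane $\operatorname{Re}(v)<\frac12$.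 **Theorem 3.2.** Let $\alpha,\alpha',\beta,\beta',\gamma,\rho,a\in\mathbb C$ and $\mu\in\mathbb R$ be such that $\operatorname{Re}(\gamma)>0$, $\mu>0$, $a\neq0$ and $$\operatorname{Re}(\rho)>\max\{\operatorname{Re}(\beta),\ \operatorname{Re}(-\alpha-\alpha'+\gamma),\ \operatorname{Re}(-\alpha-\beta'+\gamma)\}.$$ Assume that $I^{m,n}_{p,q}\big[\,\cdot\,\big|{(a_i,A_i,\alpha_i)_{1,p}\atop (b_j,B_j,\beta_j)_{1,q}}\big]$ is admissible at $a$. Then it is admissible at $at^{-\mu}$ for every $t>0$, and for every $x>0$ the integral on the left-hand side below converges absolutely, the $I$-function on the right-hand side is admissible at $ax^{-\mu}$, and $$\Big(\mathcal I_-^{\alpha,\alpha',\beta,\beta',\gamma}\Big(t^{-\rho}\,I^{m,n}_{p,q}\Big[at^{-\mu}\Big|{(a_i,A_i,\alpha_i)_{1,p}\atop (b_j,B_j,\beta_j)_{1,q}}\Big]\Big)\Big)(x)=x^{-\alpha-\alpha'+\gamma-\rho}\,I^{m,n+3}_{p+3,q+3}\Big[ax^{-\mu}\Big|{U\atop L}\Big],$$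 where the upper triples are, in this order, $$U=(1+\beta-\rho,\mu,1),\ (1-\alpha-\alpha'+\gamma-\rho,\mu,1),\ (1-\alpha-\beta'+\gamma-\rho,\mu,1),\ (a_i,A_i,\alpha_i)_{1,p},$$ and the lower triples are, in this order, $$L=(b_j,B_j,\beta_j)_{1,q},\ (1-\rho,\mu,1),\ (1-\alpha+\beta-\rho,\mu,1),\ (1-\alpha-\alpha'-\beta'+\gamma-\rho,\mu,1).$$ -/

import Mathlib

/-- The logarithm of the Gamma function on `ℂ ∖ (-∞, 0]`, by its Weierstrass series
`-γ z - log z + ∑_{k ≥ 1} (z / k - log (1 + z / k))` with `γ` the Euler-Mascheroni constant and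
principal logarithms. It is analytic on `ℂ ∖ (-∞, 0]`, real on `(0, ∞)`, and
`exp (logGamma z) = Γ z`, see `exp_logGamma`. -/
noncomputable def logGamma (z : ℂ) : ℂ :=
  -(Real.eulerMascheroniConstant : ℂ) * z - Complex.log z
    + ∑' k : ℕ, (z / ((k : ℂ) + 1) - Complex.log (1 + z / ((k : ℂ) + 1)))

/-- `logGamma` is a logarithm of the Gamma function off the poles. -/
theorem exp_logGamma (z : ℂ) (hz : ∀ k : ℕ, z ≠ -(k : ℂ)) :
    Complex.exp (logGamma z) = Complex.Gamma z := by
  have hs : Summable (fun k : ℕ => z / ((k : ℂ) + 1) - Complex.log (1 + z / ((k : ℂ) + 1))) := by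
    have hb : Summable (fun k : ℕ => ‖z‖ ^ 2 * (1 / ((k : ℝ) + 1) ^ 2)) := by
      apply Summable.mul_left
      exact_mod_cast (summable_nat_add_iff (f := fun k : ℕ => 1 / (k : ℝ) ^ 2) 1).2
        (Real.summable_one_div_nat_pow.2 one_lt_two)
    refine Summable.of_norm_bounded_eventually_nat hb ?_
    filter_upwards [Filter.eventually_ge_atTop (Nat.ceil (2 * ‖z‖))] with k hk
    have hk' : 2 * ‖z‖ ≤ k := (Nat.le_ceil _).trans (by exact_mod_cast hk)
    have hk0 : (0 : ℝ) < (k : ℝ) + 1 := by positivity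
    have hn : ‖z / ((k : ℂ) + 1)‖ = ‖z‖ / ((k : ℝ) + 1) := by
      rw [norm_div]; congr 1; exact_mod_cast Complex.norm_natCast (k + 1)
    have hlt : ‖z / ((k : ℂ) + 1)‖ ≤ 1 / 2 := by
      rw [hn, div_le_iff₀ hk0]; linarith
    have h := Complex.norm_log_one_add_sub_self_le (hlt.trans_lt (by norm_num))
    rw [← norm_neg, neg_sub] at h
    refine h.trans ?_
    have h2 : (1 - ‖z / ((k : ℂ) + 1)‖)⁻¹ ≤ 2 := by
      rw [inv_le_comm₀ (by linarith) (by norm_num)]; linarith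
    calc _ ≤ ‖z / ((k : ℂ) + 1)‖ ^ 2 * 2 / 2 := by gcongr
      _ = _ := by rw [hn]; field_simp
  have hz0 : z ≠ 0 := by simpa using hz 0
  have ht := hs.hasSum.tendsto_sum_nat
  have hH : Filter.Tendsto (fun n : ℕ => ((((harmonic n : ℚ) : ℝ) - Real.log n : ℝ) : ℂ))
      Filter.atTop (nhds (Real.eulerMascheroniConstant : ℂ)) :=
    (Complex.continuous_ofReal.tendsto _).comp Real.tendsto_harmonic_sub_log
  have hlim : Filter.Tendsto (fun n : ℕ => Complex.exp
      (-((((harmonic n : ℚ) : ℝ) - Real.log n : ℝ) : ℂ) * z - Complex.log z +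
        ∑ k ∈ Finset.range n, (z / ((k : ℂ) + 1) - Complex.log (1 + z / ((k : ℂ) + 1)))))
      Filter.atTop (nhds (Complex.exp (logGamma z))) :=
    (Complex.continuous_exp.tendsto _).comp (((hH.neg.mul_const z).sub_const _).add ht)
  refine tendsto_nhds_unique hlim ((Complex.GammaSeq_tendsto_Gamma z).congr' ?_)
  filter_upwards [Filter.eventually_gt_atTop 0] with n hn
  have hn0 : (n : ℂ) ≠ 0 := by exact_mod_cast hn.ne'
  have hk1 : ∀ k : ℕ, (k : ℂ) + 1 ≠ 0 := fun k => by exact_mod_cast k.succ_ne_zero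
  have hne : ∀ k : ℕ, 1 + z / ((k : ℂ) + 1) ≠ 0 := by
    intro k h
    apply hz (k + 1)
    have := hk1 k
    field_simp at h
    push_cast
    linear_combination h
  have hsum : ((((harmonic n : ℚ) : ℝ) : ℂ)) * z = ∑ k ∈ Finset.range n, z / ((k : ℂ) + 1) := by
    rw [harmonic]; push_cast; rw [Finset.sum_mul]
    refine Finset.sum_congr rfl fun k _ => by rw [div_eq_mul_inv, mul_comm]
  have harg : (-((((harmonic n : ℚ) : ℝ) - Real.log n : ℝ) : ℂ) * z - Complex.log z +
        ∑ k ∈ Finset.range n, (z / ((k : ℂ) + 1) - Complex.log (1 + z / ((k : ℂ) + 1)))) =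
      Complex.log n * z - Complex.log z
        - ∑ k ∈ Finset.range n, Complex.log (1 + z / ((k : ℂ) + 1)) := by
    rw [Finset.sum_sub_distrib, ← hsum, Complex.ofReal_sub, Complex.ofReal_log (by positivity)]
    push_cast; ring
  rw [harg, Complex.exp_sub, Complex.exp_sub, Complex.exp_log hz0, Complex.exp_sum,
    Complex.GammaSeq, Complex.cpow_def_of_ne_zero hn0, Finset.prod_range_succ']
  have hprod : ∏ j ∈ Finset.range n, (z + ((j + 1 : ℕ) : ℂ)) =
      (n.factorial : ℂ) * ∏ k ∈ Finset.range n, Complex.exp (Complex.log (1 + z / ((k : ℂ) + 1))) := by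
    rw [← Finset.prod_range_add_one_eq_factorial]
    push_cast
    rw [← Finset.prod_mul_distrib]
    refine Finset.prod_congr rfl fun k _ => ?_
    rw [Complex.exp_log (hne k)]
    have := hk1 k
    field_simp
    ring
  rw [hprod]
  have hf : (n.factorial : ℂ) ≠ 0 := by exact_mod_cast n.factorial_ne_zero
  have hp : ∏ k ∈ Finset.range n, Complex.exp (Complex.log (1 + z / ((k : ℂ) + 1))) ≠ 0 :=
    Finset.prod_ne_zero_iff.2 fun k _ => Complex.exp_ne_zero _
  generalize ∏ k ∈ Finset.range n, Complex.exp (Complex.log (1 + z / ((k : ℂ) + 1))) = P at hp ⊢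
  rw [Nat.cast_zero, add_zero]
  field_simp

/-- The real power `Γ(z)^κ = exp (κ log Γ(z))`. At the poles of `Γ` (the only points where
Mathlib's `Complex.Gamma` vanishes) it gets the value `0`, so that `1 / Γ(z)^κ` has there its
correct value `0` for `κ > 0`. -/
noncomputable def gammaPow (κ : ℝ) (z : ℂ) : ℂ :=
  if Complex.Gamma z = 0 then 0 else Complex.exp ((κ : ℂ) * logGamma z)

/-- With exponent `1` the power is the Gamma function itself. -/
theorem gammaPow_one (z : ℂ) : gammaPow 1 z = Complex.Gamma z := by
  unfold gammaPow
  split_ifs with h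
  · exact h.symm
  · rw [Complex.ofReal_one, one_mul]
    exact exp_logGamma z fun k hk => h (hk ▸ Complex.Gamma_neg_nat_eq_zero k)

/-- A parameter triple `(a, A, κ)` of the `I`-function. -/
structure GammaTriple where
  /-- the complex shift, `a_i` or `b_j` -/
  a : ℂ
  /-- the coefficient of `s`, `A_i` or `B_j` -/
  A : ℝ
  /-- the exponent of the Gamma factor, `α_i` or `β_j` -/
  κ : ℝ

/-- The function `χ(s)` in the Mellin-Barnes integral. The upper triples `(a_i, A_i, α_i)` are
`u`, the lower triples `(b_j, B_j, β_j)` are `l`; indices start at `0`, so the index `j < m` stands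
for `1 ≤ j ≤ m` in the usual numbering. -/
noncomputable def iKernel (m n : ℕ) {p q : ℕ} (u : Fin p → GammaTriple) (l : Fin q → GammaTriple)
    (s : ℂ) : ℂ :=
  ((∏ j with j.val < m, gammaPow (l j).κ ((l j).a + (l j).A * s)) *
      (∏ i with i.val < n, gammaPow (u i).κ (1 - (u i).a - (u i).A * s))) /
    ((∏ j with m ≤ j.val, gammaPow (l j).κ (1 - (l j).a - (l j).A * s)) *
      (∏ i with n ≤ i.val, gammaPow (u i).κ ((u i).a + (u i).A * s)))

/-- The `I`-function `I^{m,n}_{p,q}[z | u ; l] = (1 / 2πi) ∫_C χ(s) z^{-s} ds`, with `C` the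
imaginary axis `s = i y`, `ds = i dy`, traversed upwards. -/
noncomputable def iFunction (m n : ℕ) {p q : ℕ} (u : Fin p → GammaTriple)
    (l : Fin q → GammaTriple) (z : ℂ) : ℂ :=
  1 / (2 * Real.pi * Complex.I) *
    ∫ y : ℝ, iKernel m n u l (Complex.I * y) * z ^ (-(Complex.I * y)) * Complex.I

/-- The data `m, n, p, q`, the parameters and the argument `z` are admissible for the `I`-function
with contour the imaginary axis: sizes and positivity are as required, the contour has all
singularities of `Γ^{β_j}(b_j + B_j s)`, `j ≤ m`, on its left and all singularities of
`Γ^{α_i}(1 - a_i - A_i s)`, `i ≤ n`, on its right, and the contour integral converges absolutely. -/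
structure IFunctionAdmissible (m n : ℕ) {p q : ℕ} (u : Fin p → GammaTriple)
    (l : Fin q → GammaTriple) (z : ℂ) : Prop where
  m_le : m ≤ q
  n_le : n ≤ p
  upper_pos : ∀ i, 0 < (u i).A ∧ 0 < (u i).κ
  lower_pos : ∀ j, 0 < (l j).A ∧ 0 < (l j).κ
  left_of_contour : ∀ j : Fin q, j.val < m → ∀ (k : ℕ) (s : ℂ),
    (l j).a + (l j).A * s = -(k : ℂ) → s.re < 0
  right_of_contour : ∀ i : Fin p, i.val < n → ∀ (k : ℕ) (s : ℂ),
    1 - (u i).a - (u i).A * s = -(k : ℂ) → 0 < s.re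
  arg_ne_zero : z ≠ 0
  converges : MeasureTheory.Integrable
    (fun y : ℝ => iKernel m n u l (Complex.I * y) * z ^ (-(Complex.I * y)))

/-- The Pochhammer symbol `(z)_n = z (z + 1) ⋯ (z + n - 1)`. -/
noncomputable def pochhammerC (z : ℂ) (n : ℕ) : ℂ := (ascPochhammer ℂ n).eval z

/-- The double power series of the third Appell function `F₃(α, α', β, β'; γ; x; y)`, absolutely
convergent for `max |x| |y| < 1`. -/
noncomputable def appellF3Series (α α' β β' γ x y : ℂ) : ℂ :=
  ∑' k : ℕ × ℕ,
    pochhammerC α k.1 * pochhammerC α' k.2 * pochhammerC β k.1 * pochhammerC β' k.2 /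
        pochhammerC γ (k.1 + k.2) *
      (x ^ k.1 * y ^ k.2 / ((k.1.factorial : ℂ) * (k.2.factorial : ℂ)))

/-- A connected open set of second arguments to which `F₃(α, α', β, β'; γ; x; ·)`, `|x| < 1`, is
continued: the unit disc together with the half plane `Re y < 1/2`. It contains `(-∞, 0]`. -/
def appellF3Domain : Set ℂ := Metric.ball 0 1 ∪ {y | y.re < 1 / 2}

/-- `g` is the (unique) analytic continuation of `y ↦ F₃(α, α', β, β'; γ; x; y)` from the unit disc
to `appellF3Domain`. -/
def IsAppellF3Continuation (α α' β β' γ x : ℂ) (g : ℂ → ℂ) : Prop :=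
  DifferentiableOn ℂ g appellF3Domain ∧
    ∀ y : ℂ, ‖y‖ < 1 → g y = appellF3Series α α' β β' γ x y

open Classical in
/-- The third Appell function `F₃(α, α', β, β'; γ; x; y)` for `|x| < 1` and `y` in
`appellF3Domain`: the sum of its double series for `|y| < 1`, and the value of the analytic
continuation of that sum in `y` otherwise. The continuation is needed because the second argument
`1 - t / x` in the kernel of the fractional integral runs through `(-∞, 0)`. -/
noncomputable def appellF3 (α α' β β' γ x y : ℂ) : ℂ :=
  if h : ∃ g, IsAppellF3Continuation α α' β β' γ x g then h.choose y else 0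

/-- The integrand of the right-sided Marichev-Saigo-Maeda fractional integral. -/
noncomputable def msmRightIntegrand (α α' β β' γ : ℂ) (f : ℝ → ℂ) (x t : ℝ) : ℂ :=
  ((t - x : ℝ) : ℂ) ^ (γ - 1) * (t : ℂ) ^ (-α) *
    appellF3 α α' β β' γ ((1 - x / t : ℝ) : ℂ) ((1 - t / x : ℝ) : ℂ) * f t

/-- The right-sided Marichev-Saigo-Maeda fractional integral
`(x^{-α'} / Γ(γ)) ∫_x^∞ (t-x)^{γ-1} t^{-α} F₃(α, α', β, β'; γ; 1 - x/t; 1 - t/x) f(t) dt`. -/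
noncomputable def msmRight (α α' β β' γ : ℂ) (f : ℝ → ℂ) (x : ℝ) : ℂ :=
  (x : ℂ) ^ (-α') / Complex.Gamma γ *
    ∫ t in Set.Ioi x, msmRightIntegrand α α' β β' γ f x t

open Filter Topology MeasureTheory


/-! On the contour `s = iy` the variable `t` enters `t^{-ρ} (a t^{-μ})^{-s}` only through the power
`t^{-σ}` with `σ = ρ - μ s`, and `Re σ = Re ρ` there. The theorem is thus the fractional integral of
a power, moved under the Mellin-Barnes integral by Fubini. Fubini applies because `t` and `y` are
coupled only by a phase of modulus one. The integral of `t^{-σ}` is a power of `x` times `Γ(γ)`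
times `msmGammaRatio`, whose six Gamma factors are those of the six new triples
(`msmRightIntegrand_cpow_integral`).

For a power, `t = x / (1 - u)` turns the arguments of `F₃` into `u` and `-u / (1 - u)`. Pfaff's
transformation in the second argument yields the continuation to `Re y < 1/2` and replaces that
argument by `u`, so the kernel becomes a double series of beta integrands. Integrated term by term,
it is summed by Gauss's theorem, first over one index and then over the other
(`hasSum_gauss_gauss`). The interchange is justified for `Re α' > 0`; a contiguous relation
satisfied by both sides (`appellF3_contiguous`, `msmGammaRatio_contiguous`) then lowers `α'` step by
step.

Gauss's theorem (`tsum_gaussTerm`) follows from a contiguous relation in `c` and the limit `c → ∞`;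
Pfaff's transformation follows from the Chu-Vandermonde identity and the binomial series. -/

/-! ### Pochhammer symbols and their growth -/

theorem Real.tendsto_natCast_div_natCast_add (b : ℝ) :
    Tendsto (fun n : ℕ => (n : ℝ) / (n + b)) atTop (𝓝 1) := by
  simpa using tendsto_natCast_div_add_atTop (𝕜 := ℝ) b

theorem pochhammerC_zero (z : ℂ) : pochhammerC z 0 = 1 := by simp [pochhammerC]

theorem pochhammerC_succ (z : ℂ) (n : ℕ) : pochhammerC z (n + 1) = pochhammerC z n * (z + n) := by
  simp [pochhammerC, ascPochhammer_succ_eval]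

theorem pochhammerC_add (z : ℂ) (k l : ℕ) :
    pochhammerC z (k + l) = pochhammerC z k * pochhammerC (z + k) l := by
  induction l with
  | zero => simp [pochhammerC_zero]
  | succ l ih => rw [← add_assoc, pochhammerC_succ, pochhammerC_succ, ih]; push_cast; ring

theorem pochhammerC_succ_left (z : ℂ) (n : ℕ) :
    pochhammerC z (n + 1) = z * pochhammerC (z + 1) n := by
  rw [add_comm, pochhammerC_add, pochhammerC_succ, pochhammerC_zero]; simp

theorem pochhammerC_eq_prod (z : ℂ) (n : ℕ) :
    pochhammerC z n = ∏ j ∈ Finset.range n, (z + j) := by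
  induction n with
  | zero => simp [pochhammerC_zero]
  | succ n ih => rw [pochhammerC_succ, Finset.prod_range_succ, ih]

theorem pochhammerC_ne_zero {z : ℂ} (hz : ∀ m : ℕ, z ≠ -m) (n : ℕ) : pochhammerC z n ≠ 0 := by
  rw [pochhammerC_eq_prod]
  exact Finset.prod_ne_zero_iff.2 fun j _ h => hz j (eq_neg_of_add_eq_zero_left h)

theorem ne_neg_natCast_of_re_pos {z : ℂ} (hz : 0 < z.re) (m : ℕ) : z ≠ -m := by
  rintro rfl
  simp at hz
  linarith [(Nat.cast_nonneg m : (0 : ℝ) ≤ m)]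

theorem Gamma_add_natCast {z : ℂ} (hz : ∀ m : ℕ, z ≠ -m) (n : ℕ) :
    Complex.Gamma (z + n) = Complex.Gamma z * pochhammerC z n := by
  induction n with
  | zero => simp [pochhammerC_zero]
  | succ n ih =>
    rw [pochhammerC_succ, Nat.cast_succ, ← add_assoc, Complex.Gamma_add_one, ih]
    · ring
    · exact fun h => hz n (eq_neg_of_add_eq_zero_left h)

/-- Euler's limit formula for `Γ`, inverted so that it also holds at the poles. -/
theorem tendsto_pochhammerC_div (z : ℂ) :
    Tendsto (fun n : ℕ => pochhammerC z (n + 1) / ((n : ℂ) ^ z * n.factorial)) atTop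
      (𝓝 (Complex.Gamma z)⁻¹) := by
  have he : (fun n : ℕ => pochhammerC z (n + 1) / ((n : ℂ) ^ z * n.factorial)) =
      fun n => (Complex.GammaSeq z n)⁻¹ := by
    ext n
    rw [Complex.GammaSeq, inv_div, pochhammerC_eq_prod]
  rw [he]
  by_cases h : Complex.Gamma z = 0
  · obtain ⟨m, rfl⟩ := Complex.Gamma_eq_zero_iff _ |>.1 h
    rw [h, inv_zero]
    -- At `z = -m` the product contains the factor `0` once `n ≥ m`, and the limit is `0⁻¹ = 0`.
    refine tendsto_const_nhds.congr' ?_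
    filter_upwards [eventually_ge_atTop m] with n hn
    have : ∏ j ∈ Finset.range (n + 1), (-(m : ℂ) + j) = 0 :=
      Finset.prod_eq_zero (Finset.mem_range.2 (Nat.lt_succ_of_le hn)) (by simp)
    simp [Complex.GammaSeq, this]
  · exact (Complex.GammaSeq_tendsto_Gamma z).inv₀ h

/-- The growth `n! (n + 1)^{x - 1}` of `|(z)_n|` for `Re z = x`. -/
noncomputable def pochhammerGrowth (x : ℝ) (n : ℕ) : ℝ := n.factorial * ((n : ℝ) + 1) ^ (x - 1)

theorem pochhammerGrowth_pos (x : ℝ) (n : ℕ) : 0 < pochhammerGrowth x n := by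
  unfold pochhammerGrowth; positivity

theorem tendsto_norm_pochhammerC_div_growth (z : ℂ) :
    Tendsto (fun n : ℕ => ‖pochhammerC z n‖ / pochhammerGrowth z.re n) atTop
      (𝓝 ‖(Complex.Gamma z)⁻¹‖) := by
  rw [← tendsto_add_atTop_iff_nat 1]
  have h1 := (tendsto_pochhammerC_div z).norm
  -- The ratio of Euler's normalisation `n^x n!` to `pochhammerGrowth x (n + 1)`.
  have h2 : Tendsto (fun n : ℕ => ((n : ℝ) / (n + 2)) ^ z.re * (((n : ℝ) / (n + 1)) /
      ((n : ℝ) / (n + 2)))) atTop (𝓝 1) := by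
    have := ((Real.tendsto_natCast_div_natCast_add 2).rpow_const (p := z.re) (Or.inl one_ne_zero)).mul
      ((Real.tendsto_natCast_div_natCast_add 1).div (Real.tendsto_natCast_div_natCast_add 2)
        one_ne_zero)
    simpa using this
  have h3 := h1.mul h2
  rw [mul_one] at h3
  refine h3.congr' ?_
  filter_upwards [eventually_gt_atTop 0] with n hn
  have hn' : (0 : ℝ) < n := by exact_mod_cast hn
  rw [norm_div, norm_mul, Complex.norm_natCast_cpow_of_pos hn, Complex.norm_natCast,
    pochhammerGrowth, Real.div_rpow hn'.le (by positivity), Nat.factorial_succ]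
  push_cast
  rw [show (n : ℝ) + 1 + 1 = n + 2 by ring, Real.rpow_sub_one (by positivity)]
  have : (0 : ℝ) < n.factorial := by positivity
  have h4 : (0 : ℝ) < (n : ℝ) ^ z.re := by positivity
  have h5 : (0 : ℝ) < ((n : ℝ) + 2) ^ z.re := by positivity
  field_simp

theorem exists_pochhammerC_bounds {z : ℂ} (hz : ∀ m : ℕ, z ≠ -m) :
    ∃ C : ℝ, 0 < C ∧ ∀ n, ‖pochhammerC z n‖ ≤ C * pochhammerGrowth z.re n ∧
      pochhammerGrowth z.re n ≤ C * ‖pochhammerC z n‖ := by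
  have h := tendsto_norm_pochhammerC_div_growth z
  have hG : Complex.Gamma z ≠ 0 := fun h => by
    obtain ⟨m, hm⟩ := Complex.Gamma_eq_zero_iff _ |>.1 h
    exact hz m hm
  obtain ⟨C, hC⟩ := h.bddAbove_range
  obtain ⟨D, hD⟩ := (h.inv₀ (by simpa using hG)).bddAbove_range
  refine ⟨max C D ⊔ 1, by positivity, fun n => ?_⟩
  have h1 : _ ≤ C := hC (Set.mem_range_self n)
  have h2 : _ ≤ D := hD (Set.mem_range_self n)
  have hp := norm_pos_iff.2 (pochhammerC_ne_zero hz n)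
  have hg := pochhammerGrowth_pos z.re n
  simp only [inv_div] at h1 h2
  rw [div_le_iff₀ (by assumption)] at h1 h2
  constructor
  · exact h1.trans (by gcongr; simp)
  · exact h2.trans (by gcongr; simp)

/-- A bound for `(z + k)_l` that is uniform in `k` and `l` and holds for every `z`. -/
theorem exists_pochhammerC_add_le (z : ℂ) :
    ∃ C : ℝ, 0 < C ∧ ∀ k l : ℕ, ‖pochhammerC (z + k) l‖ ≤
      C * (pochhammerGrowth z.re (k + l) / pochhammerGrowth z.re k) := by
  -- Moving `z` off the real axis keeps the growth rate, enlarges every factor `z + j` in norm and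
  -- excludes zeros, so that division by `(w)_k` is possible.
  set w : ℂ := ⟨z.re, |z.im| + 1⟩ with hw
  have hwp : ∀ m : ℕ, w ≠ -m := fun m h => by
    have := congrArg Complex.im h
    simp [hw] at this
    linarith [abs_nonneg z.im]
  obtain ⟨C, hC0, hC⟩ := exists_pochhammerC_bounds hwp
  refine ⟨C * C, by positivity, fun k l => ?_⟩
  have h1 : ‖pochhammerC (z + k) l‖ ≤ ‖pochhammerC (w + k) l‖ := by
    rw [pochhammerC_eq_prod, pochhammerC_eq_prod, norm_prod, norm_prod]
    refine Finset.prod_le_prod (fun _ _ => norm_nonneg _) fun j _ => ?_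
    rw [← sq_le_sq₀ (norm_nonneg _) (norm_nonneg _), ← Complex.normSq_eq_norm_sq,
      ← Complex.normSq_eq_norm_sq, Complex.normSq_apply, Complex.normSq_apply]
    simp only [hw, Complex.add_re, Complex.add_im, Complex.natCast_re, Complex.natCast_im, add_zero]
    nlinarith [abs_nonneg z.im, abs_mul_abs_self z.im]
  have h2 := norm_pos_iff.2 (pochhammerC_ne_zero hwp k)
  have h3 : ‖pochhammerC (w + k) l‖ = ‖pochhammerC w (k + l)‖ / ‖pochhammerC w k‖ := by
    rw [pochhammerC_add, norm_mul]; field_simp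
  have hg := pochhammerGrowth_pos z.re k
  have hg' := pochhammerGrowth_pos z.re (k + l)
  have ha := (hC (k + l)).1
  have hb := (hC k).2
  refine h1.trans ?_
  rw [h3, ← mul_div_assoc, div_le_div_iff₀ h2 hg]
  calc ‖pochhammerC w (k + l)‖ * pochhammerGrowth z.re k
      ≤ (C * pochhammerGrowth z.re (k + l)) * (C * ‖pochhammerC w k‖) := by
        gcongr
    _ = _ := by ring

theorem exists_pochhammerC_le (z : ℂ) :
    ∃ C : ℝ, 0 < C ∧ ∀ n : ℕ, ‖pochhammerC z n‖ ≤ C * pochhammerGrowth z.re n := by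
  obtain ⟨C, hC, h⟩ := exists_pochhammerC_add_le z
  exact ⟨C, hC, fun n => by simpa [pochhammerGrowth] using h 0 n⟩

/-- Descending induction on the real part. -/
theorem Complex.induction_of_re_pos {P : ℂ → Prop} (h0 : ∀ z, 0 < z.re → P z)
    (h1 : ∀ z, P (z + 1) → P z) (z : ℂ) : P z := by
  obtain ⟨n, hn⟩ := exists_nat_gt (-z.re)
  have : ∀ n : ℕ, ∀ z : ℂ, -z.re < n → P z := by
    intro n
    induction n with
    | zero => exact fun z hz => h0 z (by simpa using hz)
    | succ n ih =>
      refine fun z hz => h1 z (ih _ ?_)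
      simp only [Complex.add_re, Complex.one_re]
      push_cast at hz
      linarith
  exact this n z hn

/-- For `Re c > 0` this is `Γ(c + n) = Γ(c) (c)_n`. Further left, `1 / Γ(z) = z / Γ(z + 1)` costs a
factor of order `n + 1`, which is exactly the ratio of the two growth rates. Poles need no
exception. -/
theorem exists_Gamma_inv_le (c : ℂ) :
    ∃ C : ℝ, 0 < C ∧ ∀ n : ℕ, ‖(Complex.Gamma (c + n))⁻¹‖ ≤ C / pochhammerGrowth c.re n := by
  induction c using Complex.induction_of_re_pos with
  | h0 c hc =>
    obtain ⟨C, hC, h⟩ := exists_pochhammerC_bounds (ne_neg_natCast_of_re_pos hc)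
    refine ⟨C * ‖(Complex.Gamma c)⁻¹‖, ?_, fun n => ?_⟩
    · exact mul_pos hC (norm_pos_iff.2 (inv_ne_zero (Complex.Gamma_ne_zero_of_re_pos hc)))
    · rw [Gamma_add_natCast (ne_neg_natCast_of_re_pos hc), mul_inv, norm_mul, mul_comm C, mul_div_assoc]
      gcongr
      have hp := norm_pos_iff.2 (pochhammerC_ne_zero (ne_neg_natCast_of_re_pos hc) n)
      rw [norm_inv, inv_eq_one_div, div_le_div_iff₀ hp (pochhammerGrowth_pos _ _), one_mul]
      exact (h n).2
  | h1 c ih =>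
    obtain ⟨C, hC, h⟩ := ih
    refine ⟨C * (‖c‖ + 1), by positivity, fun n => ?_⟩
    have h1 := Complex.one_div_Gamma_eq_self_mul_one_div_Gamma_add_one (c + n)
    have h2 : c + n + 1 = c + 1 + n := by ring
    rw [h2] at h1
    rw [h1, norm_mul]
    have h3 : ‖c + n‖ ≤ (‖c‖ + 1) * (n + 1) := by
      refine (norm_add_le _ _).trans ?_
      rw [Complex.norm_natCast]
      nlinarith [norm_nonneg c, (Nat.cast_nonneg n : (0 : ℝ) ≤ n)]
    have h4 : pochhammerGrowth (c + 1).re n = pochhammerGrowth c.re n * (n + 1) := by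
      simp only [pochhammerGrowth, Complex.add_re, Complex.one_re]
      rw [mul_assoc, ← Real.rpow_add_one (by positivity)]
      ring_nf
    have hg := pochhammerGrowth_pos c.re n
    calc _ ≤ (‖c‖ + 1) * (n + 1) * (C / pochhammerGrowth (c + 1).re n) := by
          gcongr; exact h n
      _ = _ := by rw [h4]; field_simp

theorem summable_natCast_add_one_rpow {s : ℝ} (hs : s < -1) :
    Summable fun n : ℕ => ((n : ℝ) + 1) ^ s := by
  have := (summable_nat_add_iff 1).2 (Real.summable_nat_rpow.2 hs)
  simpa using this

theorem pochhammerGrowth_mul_div (a b c : ℝ) (l : ℕ) :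
    pochhammerGrowth a l * pochhammerGrowth b l / l.factorial / pochhammerGrowth c l =
      ((l : ℝ) + 1) ^ (a + b - c - 1) := by
  have hl : (0 : ℝ) < (l : ℝ) + 1 := by positivity
  have : (l.factorial : ℝ) ≠ 0 := by positivity
  have h : ((l : ℝ) + 1) ^ (a - 1) * ((l : ℝ) + 1) ^ (b - 1) =
      ((l : ℝ) + 1) ^ (a + b - c - 1) * ((l : ℝ) + 1) ^ (c - 1) := by
    rw [← Real.rpow_add hl, ← Real.rpow_add hl]
    ring_nf
  have h2 : ((l : ℝ) + 1) ^ (c - 1) ≠ 0 := by positivity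
  unfold pochhammerGrowth
  field_simp
  linear_combination h

/-! ### Gauss's summation theorem -/

/-- The terms of the regularised Gauss series `₂F₁(a, b; c; 1) / Γ(c)`. -/
noncomputable def gaussTerm (a b c : ℂ) (l : ℕ) : ℂ :=
  pochhammerC a l * pochhammerC b l / l.factorial * (Complex.Gamma (c + l))⁻¹

theorem exists_gaussTerm_le (a b c : ℂ) :
    ∃ C : ℝ, 0 < C ∧ ∀ l : ℕ, ‖gaussTerm a b c l‖ ≤ C * ((l : ℝ) + 1) ^ ((a + b - c).re - 1) := by
  obtain ⟨A, hA, ha⟩ := exists_pochhammerC_le a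
  obtain ⟨B, hB, hb⟩ := exists_pochhammerC_le b
  obtain ⟨C, hC, hc⟩ := exists_Gamma_inv_le c
  refine ⟨A * B * C, by positivity, fun l => ?_⟩
  rw [gaussTerm, norm_mul, norm_div, norm_mul, Complex.norm_natCast]
  calc _ ≤ (A * pochhammerGrowth a.re l) * (B * pochhammerGrowth b.re l) / l.factorial *
        (C / pochhammerGrowth c.re l) := by
        have := pochhammerGrowth_pos a.re l
        have := pochhammerGrowth_pos b.re l
        gcongr
        exacts [ha l, hb l, hc l]
    _ = _ := by
        rw [Complex.sub_re, Complex.add_re, ← pochhammerGrowth_mul_div]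
        ring

theorem summable_norm_gaussTerm {a b c : ℂ} (h : 0 < (c - a - b).re) :
    Summable fun l => ‖gaussTerm a b c l‖ := by
  obtain ⟨C, hC, hc⟩ := exists_gaussTerm_le a b c
  refine Summable.of_nonneg_of_le (fun _ => norm_nonneg _) hc
    ((summable_natCast_add_one_rpow ?_).mul_left C)
  simp only [Complex.sub_re, Complex.add_re] at h ⊢
  linarith

theorem gaussTerm_eq_mul (a b c : ℂ) (l : ℕ) :
    gaussTerm a b c l = (c + l) * gaussTerm a b (c + 1) l := by
  have h1 := Complex.one_div_Gamma_eq_self_mul_one_div_Gamma_add_one (c + l)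
  rw [show c + l + 1 = c + 1 + l by ring] at h1
  rw [gaussTerm, gaussTerm, h1]
  ring

theorem gaussTerm_succ (a b c : ℂ) (l : ℕ) :
    (l + 1) * gaussTerm a b c (l + 1) = (a + l) * (b + l) * gaussTerm a b (c + 1) l := by
  have : (l.factorial : ℂ) ≠ 0 := by exact_mod_cast l.factorial_ne_zero
  have h2 : (l : ℂ) + 1 ≠ 0 := by exact_mod_cast l.succ_ne_zero
  rw [gaussTerm, gaussTerm, pochhammerC_succ, pochhammerC_succ, Nat.factorial_succ,
    show c + ((l + 1 : ℕ) : ℂ) = c + 1 + l by push_cast; ring]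
  push_cast
  field_simp

theorem tendsto_natCast_mul_gaussTerm {a b c : ℂ} (h : 0 < (c - a - b).re) :
    Tendsto (fun l : ℕ => (l : ℂ) * gaussTerm a b c l) atTop (𝓝 0) := by
  obtain ⟨C, hC, hc⟩ := exists_gaussTerm_le a b c
  have h0 : Tendsto (fun l : ℕ => C * ((l : ℝ) + 1) ^ (-(c - a - b).re)) atTop (𝓝 0) := by
    have := (tendsto_rpow_neg_atTop h).comp (tendsto_natCast_atTop_atTop (R := ℝ))
    have := ((tendsto_add_atTop_iff_nat 1).2 this).const_mul C
    simpa using this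
  refine squeeze_zero_norm (fun l => ?_) h0
  rw [norm_mul, Complex.norm_natCast]
  have hl : (0 : ℝ) < (l : ℝ) + 1 := by positivity
  calc _ ≤ ((l : ℝ) + 1) * (C * ((l : ℝ) + 1) ^ ((a + b - c).re - 1)) := by
        gcongr
        · linarith
        · exact hc l
    _ = C * (((l : ℝ) + 1) ^ ((a + b - c).re - 1) * ((l : ℝ) + 1)) := by ring
    _ = _ := by
        rw [← Real.rpow_add_one hl.ne']
        simp only [Complex.sub_re, Complex.add_re]
        ring_nf

/-- The difference of the two series telescopes to `-n` times the `n`-th term, which tends to `0`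
because `Re (c - a - b) > 0`. -/
theorem gaussSum_contiguous {a b c : ℂ} (h : 0 < (c - a - b).re) :
    (c - a - b) * ∑' l, gaussTerm a b c l =
      (c - a) * (c - b) * ∑' l, gaussTerm a b (c + 1) l := by
  have h' : 0 < (c + 1 - a - b).re := by
    simp only [Complex.sub_re, Complex.add_re, Complex.one_re] at h ⊢; linarith
  have s1 := (summable_norm_gaussTerm h).of_norm
  have s2 := (summable_norm_gaussTerm h').of_norm
  have hs := ((s1.hasSum.mul_left (c - a - b)).sub (s2.hasSum.mul_left ((c - a) * (c - b))))
  have hl := hs.tendsto_sum_nat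
  have he : ∀ n : ℕ, ∑ l ∈ Finset.range n, ((c - a - b) * gaussTerm a b c l -
      (c - a) * (c - b) * gaussTerm a b (c + 1) l) = -(n * gaussTerm a b c n) := by
    intro n
    induction n with
    | zero => simp
    | succ n ih =>
      rw [Finset.sum_range_succ, ih]
      push_cast
      rw [gaussTerm_succ, gaussTerm_eq_mul]
      ring
  simp only [he] at hl
  have := (tendsto_natCast_mul_gaussTerm h).neg
  rw [neg_zero] at this
  exact sub_eq_zero.1 (tendsto_nhds_unique hl this)

theorem gaussSum_shift {a b c : ℂ} (h : 0 < (c - a - b).re) (n : ℕ) :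
    pochhammerC (c - a - b) n * ∑' l, gaussTerm a b c l =
      pochhammerC (c - a) n * pochhammerC (c - b) n * ∑' l, gaussTerm a b (c + n) l := by
  induction n with
  | zero => simp [pochhammerC_zero]
  | succ n ih =>
    have h' : 0 < (c + n - a - b).re := by
      simp only [Complex.sub_re, Complex.add_re, Complex.natCast_re] at h ⊢
      linarith [(Nat.cast_nonneg n : (0 : ℝ) ≤ n)]
    have h2 := gaussSum_contiguous h'
    rw [pochhammerC_succ, pochhammerC_succ, pochhammerC_succ,
      show c + ((n + 1 : ℕ) : ℂ) = c + n + 1 by push_cast; ring]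
    linear_combination (c - a - b + n) * ih + (pochhammerC (c - a) n * pochhammerC (c - b) n) * h2

/-- The factor `Γ(c + n)` undoes the regularisation and leaves `₂F₁(a, b; c + n; 1)`, of which only
the term `l = 0` survives as `n → ∞`. The dominating series comes from `|(c + n)_l| ≥ |(Re c)_l|`.
-/
theorem tendsto_gaussSum_mul_Gamma {a b c : ℂ} (hc : 0 < c.re) (h : 0 < (c - a - b).re) :
    Tendsto (fun n : ℕ => (∑' l, gaussTerm a b (c + n) l) * Complex.Gamma (c + n)) atTop (𝓝 1) := by
  have hcn : ∀ n : ℕ, 0 < (c + n).re := fun n => by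
    simp only [Complex.add_re, Complex.natCast_re]
    positivity
  have e1 : ∀ n l : ℕ, gaussTerm a b (c + n) l * Complex.Gamma (c + n) =
      pochhammerC a l * pochhammerC b l / l.factorial / pochhammerC (c + n) l := by
    intro n l
    have h1 := ne_neg_natCast_of_re_pos (hcn n)
    have h2 := Complex.Gamma_ne_zero_of_re_pos (hcn n)
    rw [gaussTerm, Gamma_add_natCast h1]
    have := pochhammerC_ne_zero h1 l
    field_simp
  have hn1 := ne_neg_natCast_of_re_pos hc
  simp only [← tsum_mul_right, e1]
  have hx : 0 < ((c.re : ℂ)).re := by simpa using hc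
  have e0 : ∑' l : ℕ, (if l = 0 then (1 : ℂ) else 0) = 1 := by simp
  rw [← e0]
  obtain ⟨A, hA, ha⟩ := exists_pochhammerC_le a
  obtain ⟨B, hB, hb⟩ := exists_pochhammerC_le b
  obtain ⟨D, hD, hd⟩ := exists_pochhammerC_bounds (ne_neg_natCast_of_re_pos hx)
  have hlow : ∀ n l : ℕ, ‖pochhammerC (c.re : ℂ) l‖ ≤ ‖pochhammerC (c + n) l‖ := by
    intro n l
    rw [pochhammerC_eq_prod, pochhammerC_eq_prod, norm_prod, norm_prod]
    refine Finset.prod_le_prod (fun _ _ => norm_nonneg _) fun j _ => ?_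
    refine le_trans ?_ (Complex.re_le_norm _)
    rw [show (c.re : ℂ) + j = ((c.re + j : ℝ) : ℂ) by push_cast; rfl, Complex.norm_real,
      Real.norm_of_nonneg (by positivity)]
    simp
  refine tendsto_tsum_of_dominated_convergence
    (bound := fun l : ℕ => A * B * D * ((l : ℝ) + 1) ^ ((a + b - c).re - 1)) ?_ ?_ ?_
  · refine (summable_natCast_add_one_rpow ?_).mul_left _
    simp only [Complex.sub_re, Complex.add_re] at h ⊢
    linarith
  · intro l
    rcases Nat.eq_zero_or_pos l with rfl | hl
    · simp [pochhammerC_zero]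
    · rw [if_neg hl.ne']
      obtain ⟨k, rfl⟩ := Nat.exists_eq_succ_of_ne_zero hl.ne'
      set K := pochhammerC a k.succ * pochhammerC b k.succ / (k.succ.factorial : ℂ)
      refine squeeze_zero_norm' ?_ (tendsto_const_div_atTop_nhds_zero_nat ‖K‖)
      filter_upwards [eventually_gt_atTop 0] with n hn
      have hn' : (0 : ℝ) < n := by exact_mod_cast hn
      rw [norm_div]
      gcongr
      -- The first factor of `(c + n)_{k + 1}` has norm at least `n`, the others at least `1`.
      have h1 : (n : ℝ) ≤ ‖c + n‖ := by
        refine le_trans ?_ (Complex.re_le_norm _)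
        simpa using hc.le
      have h2 : 1 ≤ ‖pochhammerC (c + n + 1) k‖ := by
        rw [pochhammerC_eq_prod, norm_prod]
        refine Finset.one_le_prod fun j _ => ?_
        refine le_trans ?_ (Complex.re_le_norm _)
        simp only [Complex.add_re, Complex.natCast_re, Complex.one_re]
        linarith [(Nat.cast_nonneg j : (0 : ℝ) ≤ j)]
      rw [pochhammerC_succ_left, norm_mul]
      nlinarith
  · filter_upwards with n l
    rw [norm_div, norm_div, norm_mul, Complex.norm_natCast]
    have hp := norm_pos_iff.2 (pochhammerC_ne_zero (ne_neg_natCast_of_re_pos hx) l)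
    have hg := pochhammerGrowth_pos c.re l
    have h3 : (‖pochhammerC (c + n) l‖)⁻¹ ≤ D / pochhammerGrowth c.re l := by
      calc _ ≤ (‖pochhammerC (c.re : ℂ) l‖)⁻¹ := by gcongr; exact hlow n l
        _ ≤ _ := by
          rw [inv_eq_one_div, div_le_div_iff₀ hp hg, one_mul]
          simpa using (hd l).2
    rw [div_eq_mul_inv _ ‖pochhammerC (c + n) l‖]
    calc _ ≤ (A * pochhammerGrowth a.re l) * (B * pochhammerGrowth b.re l) / l.factorial *
          (D / pochhammerGrowth c.re l) := by
          have := pochhammerGrowth_pos a.re l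
          have := pochhammerGrowth_pos b.re l
          gcongr
          exacts [ha l, hb l]
      _ = _ := by
          rw [Complex.sub_re, Complex.add_re, ← pochhammerGrowth_mul_div]
          ring

/-- Let `n → ∞` in `gaussSum_shift`: the shifted sum is asymptotic to `1 / Γ(c + n)`, and Euler's
limit evaluates the remaining Pochhammer quotient. -/
theorem tsum_gaussTerm_of_re_pos {a b c : ℂ} (hc : 0 < c.re) (h : 0 < (c - a - b).re) :
    ∑' l, gaussTerm a b c l =
      Complex.Gamma (c - a - b) / (Complex.Gamma (c - a) * Complex.Gamma (c - b)) := by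
  have hp : ∀ n, pochhammerC (c - a - b) n ≠ 0 :=
    pochhammerC_ne_zero (ne_neg_natCast_of_re_pos h)
  have hcp : ∀ n, pochhammerC c n ≠ 0 := pochhammerC_ne_zero (ne_neg_natCast_of_re_pos hc)
  have hG := Complex.Gamma_ne_zero_of_re_pos hc
  have hG' := Complex.Gamma_ne_zero_of_re_pos h
  -- Writing `Γ(c + n + 1) = Γ(c) (c)_{n + 1}` puts two Pochhammer symbols above and two below, so
  -- the factorials and the powers of `n` cancel.
  have t1 := ((tendsto_pochhammerC_div (c - a)).mul (tendsto_pochhammerC_div (c - b))).div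
    ((tendsto_pochhammerC_div (c - a - b)).mul ((tendsto_pochhammerC_div c).mul_const
      (Complex.Gamma c))) (by simp [hG, hG'])
  have t2 := t1.mul ((tendsto_add_atTop_iff_nat 1).2 (tendsto_gaussSum_mul_Gamma hc h))
  have t3 : Tendsto (fun _ : ℕ => ∑' l, gaussTerm a b c l) atTop
      (𝓝 (∑' l, gaussTerm a b c l)) := tendsto_const_nhds
  have := tendsto_nhds_unique_of_eventuallyEq t3 t2 ?_
  · rw [this]
    field_simp
  · filter_upwards [eventually_gt_atTop 0] with n hn
    have hn' : (n : ℂ) ≠ 0 := by exact_mod_cast hn.ne'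
    have hf : (n.factorial : ℂ) ≠ 0 := by exact_mod_cast n.factorial_ne_zero
    have h1 := gaussSum_shift h (n + 1)
    have h2 := Gamma_add_natCast (ne_neg_natCast_of_re_pos hc) (n + 1)
    have h3 := hp (n + 1)
    have h4 := hcp (n + 1)
    have e1 : (n : ℂ) ^ (c - a) * (n : ℂ) ^ (c - b) = (n : ℂ) ^ (c - a - b) * (n : ℂ) ^ c := by
      rw [← Complex.cpow_add _ _ hn', ← Complex.cpow_add _ _ hn']
      ring_nf
    have h5 : (n : ℂ) ^ (c - a) ≠ 0 := by simp [Complex.cpow_eq_zero_iff, hn']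
    have h6 : (n : ℂ) ^ (c - b) ≠ 0 := by simp [Complex.cpow_eq_zero_iff, hn']
    have h7 : (n : ℂ) ^ (c - a - b) ≠ 0 := by simp [Complex.cpow_eq_zero_iff, hn']
    have h8 : (n : ℂ) ^ c ≠ 0 := by simp [Complex.cpow_eq_zero_iff, hn']
    rw [h2]
    simp only [Pi.div_apply]
    field_simp
    linear_combination ((n : ℂ) ^ (c - a) * (n : ℂ) ^ (c - b)) * h1 + (pochhammerC (c - a) (n + 1) * pochhammerC (c - b) (n + 1) *
      ∑' l, gaussTerm a b (c + (n + 1 : ℕ)) l) * e1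

/-- **Gauss's summation theorem**, in regularised form. -/
theorem tsum_gaussTerm {a b c : ℂ} (h : 0 < (c - a - b).re) :
    ∑' l, gaussTerm a b c l =
      Complex.Gamma (c - a - b) / (Complex.Gamma (c - a) * Complex.Gamma (c - b)) := by
  induction c using Complex.induction_of_re_pos with
  | h0 c hc => exact tsum_gaussTerm_of_re_pos hc h
  | h1 c ih =>
    have h' : 0 < (c + 1 - a - b).re := by
      simp only [Complex.sub_re, Complex.add_re, Complex.one_re] at h ⊢; linarith
    -- The contiguous relation carries the formula from `c + 1` to `c`; this factor has to be
    -- divided out.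
    have h0 : c - a - b ≠ 0 := fun h0 => by simp [h0] at h
    have h2 := gaussSum_contiguous h
    rw [ih h', show c + 1 - a - b = c - a - b + 1 by ring, Complex.Gamma_add_one _ h0,
      show c + 1 - a = c - a + 1 by ring, show c + 1 - b = c - b + 1 by ring] at h2
    have ha := Complex.one_div_Gamma_eq_self_mul_one_div_Gamma_add_one (c - a)
    have hb := Complex.one_div_Gamma_eq_self_mul_one_div_Gamma_add_one (c - b)
    rw [div_eq_mul_inv, mul_inv, ha, hb]
    refine mul_left_cancel₀ h0 (h2.trans ?_)
    rw [div_eq_mul_inv, mul_inv]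
    ring

/-! ### Polynomial bounds and double geometric series -/

/-- Inside the discs of convergence the geometric factors absorb any polynomial, so integer
exponents `p ≥ |x - 1|` are precise enough. -/
theorem exists_pochhammerGrowth_le_pow (x : ℝ) :
    ∃ p : ℕ, ∀ n : ℕ, pochhammerGrowth x n ≤ n.factorial * ((n : ℝ) + 1) ^ p ∧
      (n.factorial : ℝ) ≤ ((n : ℝ) + 1) ^ p * pochhammerGrowth x n := by
  obtain ⟨p, hp⟩ := exists_nat_ge |x - 1|
  refine ⟨p, fun n => ?_⟩
  have h1 : (1 : ℝ) ≤ (n : ℝ) + 1 := by simp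
  have hf : (0 : ℝ) < n.factorial := by positivity
  rw [← Real.rpow_natCast, pochhammerGrowth]
  constructor
  · exact mul_le_mul_of_nonneg_left
      (Real.rpow_le_rpow_of_exponent_le h1 ((le_abs_self _).trans hp)) hf.le
  · rw [mul_left_comm, ← Real.rpow_add (by positivity)]
    refine le_mul_of_one_le_right hf.le (Real.one_le_rpow h1 ?_)
    linarith [neg_abs_le (x - 1)]

theorem exists_pochhammerC_add_le_pow (z : ℂ) :
    ∃ C : ℝ, 0 < C ∧ ∃ p : ℕ, ∀ k l : ℕ, ‖pochhammerC (z + k) l‖ ≤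
      C * ((k + l).factorial / k.factorial * (((k : ℝ) + 1) ^ p * ((k : ℝ) + l + 1) ^ p)) := by
  obtain ⟨C, hC, h⟩ := exists_pochhammerC_add_le z
  obtain ⟨p, hp⟩ := exists_pochhammerGrowth_le_pow z.re
  refine ⟨C, hC, p, fun k l => (h k l).trans ?_⟩
  have hg := pochhammerGrowth_pos z.re k
  have h1 := (hp (k + l)).1
  have h2 := (hp k).2
  have hk : (0 : ℝ) < k.factorial := by positivity
  gcongr
  rw [div_mul_eq_mul_div, div_le_div_iff₀ hg hk]
  calc _ ≤ ((k + l).factorial * (((k + l : ℕ) : ℝ) + 1) ^ p) *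
        (((k : ℝ) + 1) ^ p * pochhammerGrowth z.re k) := by gcongr
    _ = _ := by push_cast; ring

theorem exists_pochhammerC_le_pow (z : ℂ) :
    ∃ C : ℝ, 0 < C ∧ ∃ p : ℕ, ∀ n : ℕ, ‖pochhammerC z n‖ ≤
      C * (n.factorial * ((n : ℝ) + 1) ^ p) := by
  obtain ⟨C, hC, p, h⟩ := exists_pochhammerC_add_le_pow z
  exact ⟨C, hC, p, fun n => by simpa using h 0 n⟩

theorem exists_pochhammerC_inv_le_pow {z : ℂ} (hz : ∀ m : ℕ, z ≠ -m) :
    ∃ C : ℝ, 0 < C ∧ ∃ p : ℕ, ∀ n : ℕ, ‖pochhammerC z n‖⁻¹ ≤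
      C * (((n : ℝ) + 1) ^ p / n.factorial) := by
  obtain ⟨C, hC, h⟩ := exists_pochhammerC_bounds hz
  obtain ⟨p, hp⟩ := exists_pochhammerGrowth_le_pow z.re
  refine ⟨C, hC, p, fun n => ?_⟩
  have h0 := norm_pos_iff.2 (pochhammerC_ne_zero hz n)
  have hf : (0 : ℝ) < n.factorial := by positivity
  rw [← mul_div_assoc, inv_eq_one_div, div_le_div_iff₀ h0 hf, one_mul]
  calc _ ≤ ((n : ℝ) + 1) ^ p * pochhammerGrowth z.re n := (hp n).2
    _ ≤ ((n : ℝ) + 1) ^ p * (C * ‖pochhammerC z n‖) := by gcongr; exact (h n).2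
    _ = _ := by ring

theorem summable_add_one_pow_mul_geometric (p : ℕ) {r : ℝ} (h0 : 0 ≤ r) (h1 : r < 1) :
    Summable fun n : ℕ => ((n : ℝ) + 1) ^ p * r ^ n := by
  rcases h0.eq_or_lt with rfl | h0
  · refine summable_of_ne_finset_zero (s := {0}) fun n hn => ?_
    rw [zero_pow (by simpa using hn), mul_zero]
  · have := (summable_nat_add_iff 1).2 (summable_pow_mul_geometric_of_norm_lt_one p
      (r := r) (by rwa [Real.norm_of_nonneg h0.le]))
    refine (this.mul_right r⁻¹).congr fun n => ?_
    push_cast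
    rw [pow_succ]
    field_simp

theorem summable_prod_pow_mul_geometric (p q : ℕ) {r s : ℝ} (hr0 : 0 ≤ r) (hr : r < 1)
    (hs0 : 0 ≤ s) (hs : s < 1) :
    Summable fun k : ℕ × ℕ => (((k.1 : ℝ) + 1) ^ p * r ^ k.1) * (((k.2 : ℝ) + 1) ^ q * s ^ k.2) :=
  (summable_add_one_pow_mul_geometric p hr0 hr).mul_of_nonneg
    (summable_add_one_pow_mul_geometric q hs0 hs) (fun _ => by positivity) fun _ => by positivity

/-! ### Chu-Vandermonde identity, binomial series and Pfaff's transformation -/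

/-- The **Chu-Vandermonde identity**. -/
theorem sum_antidiagonal_pochhammerC (N : ℕ) (x : ℂ) {c : ℂ} (hc : ∀ m : ℕ, c ≠ -m) :
    ∑ ij ∈ Finset.HasAntidiagonal.antidiagonal N,
      (N.choose ij.1 : ℂ) * ((-1) ^ ij.1 * pochhammerC x ij.1 / pochhammerC c ij.1) =
      pochhammerC (c - x) N / pochhammerC c N := by
  induction N generalizing x c with
  | zero => simp [pochhammerC_zero]
  | succ N ih =>
    have hc1 : ∀ m : ℕ, c + 1 ≠ -m := fun m h => hc (m + 1) (by
      push_cast; linear_combination h)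
    have hc0 : c ≠ 0 := by simpa using hc 0
    have hN := pochhammerC_ne_zero hc N
    have hN1 := pochhammerC_ne_zero hc (N + 1)
    have hcN : c + N ≠ 0 := fun h => hc N (by linear_combination h)
    -- Pascal's rule splits the sum into the case `N` and a shifted sum, which is `-x / c` times the
    -- case `N` at `(x + 1, c + 1)`; the difference `c - x` does not change.
    rw [Finset.sum_antidiagonal_choose_succ_mul
      (fun i _ => (-1) ^ i * pochhammerC x i / pochhammerC c i), ih x hc]
    have h2 := ih (x + 1) hc1
    have h3 : ∑ ij ∈ Finset.HasAntidiagonal.antidiagonal N, (N.choose ij.2 : ℂ) *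
        ((-1) ^ (ij.1 + 1) * pochhammerC x (ij.1 + 1) / pochhammerC c (ij.1 + 1)) =
        -(x / c) * ∑ ij ∈ Finset.HasAntidiagonal.antidiagonal N, (N.choose ij.1 : ℂ) *
          ((-1) ^ ij.1 * pochhammerC (x + 1) ij.1 / pochhammerC (c + 1) ij.1) := by
      rw [Finset.mul_sum]
      refine Finset.sum_congr rfl fun ij hij => ?_
      rw [Finset.HasAntidiagonal.mem_antidiagonal] at hij
      rw [← Nat.choose_symm_of_eq_add (a := ij.1) (b := ij.2) hij.symm, pochhammerC_succ_left,
        pochhammerC_succ_left c]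
      have := pochhammerC_ne_zero hc1 ij.1
      field_simp
      ring
    rw [h3, h2, show c + 1 - (x + 1) = c - x by ring]
    have h4 : c * pochhammerC (c + 1) N = pochhammerC c N * (c + N) := by
      rw [← pochhammerC_succ_left, pochhammerC_succ]
    have h5 := pochhammerC_ne_zero hc1 N
    rw [pochhammerC_succ, pochhammerC_succ]
    have h6 : x / c * (pochhammerC (c - x) N / pochhammerC (c + 1) N) =
        x * pochhammerC (c - x) N / (pochhammerC c N * (c + N)) := by
      rw [← h4]; field_simp
    rw [neg_mul, h6]
    field_simp
    ring

/-- The binomial series, since `(a)_n / n!` is the binomial coefficient `Ring.choose (a + n - 1) n`.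
-/
theorem hasSum_pochhammerC_div_factorial (a : ℂ) {y : ℂ} (hy : ‖y‖ < 1) :
    HasSum (fun n : ℕ => pochhammerC a n / n.factorial * y ^ n) ((1 - y) ^ (-a)) := by
  have h := (Complex.one_div_one_sub_cpow_hasFPowerSeriesOnBall_zero a).hasSum (y := y)
    (by rw [Metric.mem_eball, edist_zero_right, ← ofReal_norm, ENNReal.ofReal_lt_one]; exact hy)
  rw [zero_add, one_div, ← Complex.cpow_neg] at h
  have e : (fun n : ℕ => pochhammerC a n / n.factorial * y ^ n) = fun n : ℕ =>
      (FormalMultilinearSeries.ofScalars ℂ (fun n : ℕ => Ring.choose (a + n - 1) n) n)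
        fun _ => y := by
    ext n
    rw [FormalMultilinearSeries.ofScalars_apply_eq, smul_eq_mul]
    congr 1
    have hf : (n.factorial : ℂ) ≠ 0 := by exact_mod_cast n.factorial_ne_zero
    rw [div_eq_iff hf, Ring.choose, mul_comm, ← nsmul_eq_mul,
      Ring.factorial_nsmul_multichoose_eq_ascPochhammer, Polynomial.ascPochhammer_smeval_eq_eval,
      pochhammerC]
    ring_nf
  rw [e]
  exact h

theorem tsum_prod_eq_tsum_sum_antidiagonal {f : ℕ × ℕ → ℂ} (hf : Summable f) :
    ∑' k, f k = ∑' n, ∑ ij ∈ Finset.HasAntidiagonal.antidiagonal n, f ij := by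
  conv_rhs =>
    congr
    ext
    rw [← Finset.sum_finset_coe, ← tsum_fintype (L := .unconditional _)]
  rw [← Finset.HasAntidiagonal.sigmaAntidiagonalEquivProd.tsum_eq f]
  exact (Finset.HasAntidiagonal.sigmaAntidiagonalEquivProd.summable_iff.2 hf).tsum_sigma'
    fun n => (hasSum_fintype _).summable

/-- The bound `(i + j)! ≤ 2^{i + j} i! j!` makes the geometric ratio `2 ‖y‖`, hence the radius `1 /
2`. -/
theorem summable_pfaff (a x : ℂ) {c y : ℂ} (hc : ∀ m : ℕ, c ≠ -m) (hy : ‖y‖ < 1 / 2) :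
    Summable fun k : ℕ × ℕ => pochhammerC a (k.1 + k.2) * y ^ (k.1 + k.2) *
      ((-1) ^ k.1 * pochhammerC x k.1 / pochhammerC c k.1 /
        ((k.1.factorial : ℂ) * k.2.factorial)) := by
  obtain ⟨A, hA, p, ha⟩ := exists_pochhammerC_le_pow a
  obtain ⟨B, hB, q, hb⟩ := exists_pochhammerC_le_pow x
  obtain ⟨D, hD, r, hd⟩ := exists_pochhammerC_inv_le_pow hc
  have hs := (summable_prod_pow_mul_geometric (p + q + r) p (r := 2 * ‖y‖) (s := 2 * ‖y‖)
    (by positivity) (by linarith) (by positivity) (by linarith)).mul_left (A * B * D)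
  refine Summable.of_norm_bounded hs fun ⟨i, j⟩ => ?_
  have hch : ((i + j).factorial : ℝ) ≤ 2 ^ i * 2 ^ j * (i.factorial * j.factorial) := by
    rw [← pow_add]
    have h1 := Nat.add_choose_mul_factorial_mul_factorial i j
    have h2 := Nat.choose_le_two_pow (i + j) j
    rw [← h1, mul_assoc]
    exact_mod_cast Nat.mul_le_mul_right _ h2
  have hp : ((i : ℝ) + j + 1) ^ p ≤ ((i : ℝ) + 1) ^ p * ((j : ℝ) + 1) ^ p := by
    rw [← mul_pow]
    gcongr
    nlinarith [mul_nonneg (Nat.cast_nonneg (α := ℝ) i) (Nat.cast_nonneg (α := ℝ) j)]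
  have hi : (0 : ℝ) < i.factorial := by positivity
  have hj : (0 : ℝ) < j.factorial := by positivity
  have ha' := ha (i + j)
  have hb' := hb i
  have hd' := hd i
  push_cast at ha'
  simp only [norm_mul, norm_div, norm_pow, norm_neg, norm_one, one_pow, one_mul,
    Complex.norm_natCast]
  calc ‖pochhammerC a (i + j)‖ * ‖y‖ ^ (i + j) * (‖pochhammerC x i‖ / ‖pochhammerC c i‖ /
        ((i.factorial : ℝ) * j.factorial))
      = ‖pochhammerC a (i + j)‖ * ‖y‖ ^ (i + j) * (‖pochhammerC x i‖ * ‖pochhammerC c i‖⁻¹ /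
        ((i.factorial : ℝ) * j.factorial)) := by ring
    _ ≤ (A * ((2 ^ i * 2 ^ j * (i.factorial * j.factorial)) *
          (((i : ℝ) + 1) ^ p * ((j : ℝ) + 1) ^ p))) * ‖y‖ ^ (i + j) *
        ((B * (i.factorial * ((i : ℝ) + 1) ^ q)) * (D * (((i : ℝ) + 1) ^ r / i.factorial)) /
        ((i.factorial : ℝ) * j.factorial)) := by
        gcongr
        refine ha'.trans ?_
        gcongr
    _ = _ := by
        field_simp
        ring

/-- **Pfaff's transformation** of the Gauss hypergeometric series near the origin. -/
theorem pfaff_transformation (a b : ℂ) {c y : ℂ} (hc : ∀ m : ℕ, c ≠ -m) (hy : ‖y‖ < 1 / 2) :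
    ∑' n : ℕ, pochhammerC a n * pochhammerC b n / pochhammerC c n * (y ^ n / n.factorial) =
      (1 - y) ^ (-a) * ∑' l : ℕ, pochhammerC a l * pochhammerC (c - b) l / pochhammerC c l *
        ((y / (y - 1)) ^ l / l.factorial) := by
  have hs := summable_pfaff a (c - b) hc hy
  have hy1 : 1 - y ≠ 0 := fun h => by
    rw [sub_eq_zero] at h
    rw [← h, norm_one] at hy
    norm_num at hy
  have hy2 : y - 1 ≠ 0 := fun h => hy1 (by linear_combination -h)
  -- One double series is summed in two ways: along the diagonals by Chu-Vandermonde, giving the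
  -- left-hand side, and along the rows by the binomial series, giving the right-hand side.
  have h1 := tsum_prod_eq_tsum_sum_antidiagonal hs
  rw [hs.tsum_prod' fun l => hs.prod_factor l] at h1
  rw [← tsum_mul_left]
  refine Eq.trans ?_ (h1.symm.trans ?_)
  · refine tsum_congr fun N => ?_
    have hN : (N.factorial : ℂ) ≠ 0 := by exact_mod_cast N.factorial_ne_zero
    have h2 := sum_antidiagonal_pochhammerC N (c - b) hc
    rw [show c - (c - b) = b by ring] at h2
    have h3 : ∀ ij ∈ Finset.HasAntidiagonal.antidiagonal N,
        pochhammerC a (ij.1 + ij.2) * y ^ (ij.1 + ij.2) *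
        ((-1) ^ ij.1 * pochhammerC (c - b) ij.1 / pochhammerC c ij.1 /
          ((ij.1.factorial : ℂ) * ij.2.factorial)) =
        pochhammerC a N * y ^ N / N.factorial * ((N.choose ij.1 : ℂ) *
          ((-1) ^ ij.1 * pochhammerC (c - b) ij.1 / pochhammerC c ij.1)) := by
      rintro ⟨i, j⟩ hij
      rw [Finset.HasAntidiagonal.mem_antidiagonal] at hij
      subst hij
      have hi : (i.factorial : ℂ) ≠ 0 := by exact_mod_cast i.factorial_ne_zero
      have hj : (j.factorial : ℂ) ≠ 0 := by exact_mod_cast j.factorial_ne_zero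
      have h4 : ((i + j).choose i : ℂ) * i.factorial * j.factorial = (i + j).factorial := by
        rw [Nat.choose_symm_add]
        exact_mod_cast Nat.add_choose_mul_factorial_mul_factorial i j
      have h5 := pochhammerC_ne_zero hc i
      simp only
      field_simp
      rw [← h4]
      ring
    rw [Finset.sum_congr rfl h3, ← Finset.mul_sum, h2]
    ring
  · refine tsum_congr fun l => ?_
    have hb := hasSum_pochhammerC_div_factorial (a + l) (y := y) (by linarith)
    have hl : (l.factorial : ℂ) ≠ 0 := by exact_mod_cast l.factorial_ne_zero
    have h5 := pochhammerC_ne_zero hc l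
    have h6 : (1 - y) ^ (-a) * (y / (y - 1)) ^ l = (-1) ^ l * y ^ l * (1 - y) ^ (-(a + l)) := by
      rw [show -(a + l) = -a - l by ring, Complex.cpow_sub _ _ hy1, Complex.cpow_natCast, div_pow,
        show y - 1 = -1 * (1 - y) by ring, mul_pow]
      have h8 : ((-1 : ℂ) ^ l) * (-1) ^ l = 1 := by rw [← mul_pow]; simp
      have h9 : ((-1 : ℂ) ^ l) ≠ 0 := by simp
      have h10 : (1 - y) ^ l ≠ 0 := pow_ne_zero _ hy1
      field_simp
      linear_combination (-(1 - y) ^ (-a) * y ^ l) * h8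
    have h7 : ∀ j : ℕ, pochhammerC a (l + j) * y ^ (l + j) *
        ((-1) ^ l * pochhammerC (c - b) l / pochhammerC c l /
          ((l.factorial : ℂ) * j.factorial)) =
        pochhammerC a l * pochhammerC (c - b) l / pochhammerC c l / l.factorial *
          ((-1) ^ l * y ^ l) * (pochhammerC (a + l) j / j.factorial * y ^ j) := by
      intro j
      have hj : (j.factorial : ℂ) ≠ 0 := by exact_mod_cast j.factorial_ne_zero
      rw [pochhammerC_add, pow_add]
      field_simp
    simp only [h7]
    rw [tsum_mul_left, hb.tsum_eq]
    linear_combination -(pochhammerC a l * pochhammerC (c - b) l / pochhammerC c l / l.factorial) *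
      h6

/-! ### The Appell function `F₃` and its continuation -/

/-- The coefficients `d k l` grow at most polynomially in `k` and `l`. -/
def HasPolyGrowth (d : ℕ × ℕ → ℂ) : Prop :=
  ∃ C : ℝ, ∃ p : ℕ, ∀ k, ‖d k‖ ≤ C * (((k.1 : ℝ) + 1) ^ p * ((k.2 : ℝ) + 1) ^ p)

theorem HasPolyGrowth.summable_bound {C : ℝ} {p : ℕ} {x : ℂ} (hx : ‖x‖ < 1) {r : ℝ} (h0 : 0 ≤ r)
    (hr : r < 1) : Summable fun k : ℕ × ℕ => C * (((k.1 : ℝ) + 1) ^ p * ((k.2 : ℝ) + 1) ^ p) *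
      (‖x‖ ^ k.1 * r ^ k.2) :=
  ((summable_prod_pow_mul_geometric p p (norm_nonneg x) hx h0 hr).mul_left C).congr
    fun k => by ring

theorem HasPolyGrowth.summable_norm {d : ℕ × ℕ → ℂ} (hd : HasPolyGrowth d) {x y : ℂ} (hx : ‖x‖ < 1)
    (hy : ‖y‖ < 1) : Summable fun k : ℕ × ℕ => ‖d k * (x ^ k.1 * y ^ k.2)‖ := by
  obtain ⟨C, p, h⟩ := hd
  refine Summable.of_nonneg_of_le (fun _ => norm_nonneg _) (fun k => ?_)
    (summable_bound (C := C) (p := p) hx (norm_nonneg y) hy)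
  rw [norm_mul, norm_mul, norm_pow, norm_pow]
  gcongr
  exact h k

theorem HasPolyGrowth.differentiableOn {d : ℕ × ℕ → ℂ} (hd : HasPolyGrowth d) {x : ℂ}
    (hx : ‖x‖ < 1) :
    DifferentiableOn ℂ (fun y => ∑' k : ℕ × ℕ, d k * (x ^ k.1 * y ^ k.2)) (Metric.ball 0 1) := by
  obtain ⟨C, p, h⟩ := hd
  intro y hy
  rw [mem_ball_zero_iff] at hy
  obtain ⟨r, hr, hr1⟩ := exists_between hy
  have hr0 : 0 ≤ r := (norm_nonneg y).trans hr.le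
  have := Complex.differentiableOn_tsum_of_summable_norm
    (F := fun (k : ℕ × ℕ) (y : ℂ) => d k * (x ^ k.1 * y ^ k.2)) (U := Metric.ball 0 r)
    (summable_bound (C := C) (p := p) hx hr0 hr1) (fun k => by fun_prop) Metric.isOpen_ball ?_
  · exact (this.differentiableAt (Metric.isOpen_ball.mem_nhds (by simpa using hr)))
      |>.differentiableWithinAt
  · intro k w hw
    rw [mem_ball_zero_iff] at hw
    rw [norm_mul, norm_mul, norm_pow, norm_pow]
    have h0 := (norm_nonneg _).trans (h k)
    gcongr
    exact h k

/-- The coefficients of the double series of `F₃`. -/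
noncomputable def appellF3Coeff (α α' β β' γ : ℂ) (k : ℕ × ℕ) : ℂ :=
  pochhammerC α k.1 * pochhammerC α' k.2 * pochhammerC β k.1 * pochhammerC β' k.2 /
    pochhammerC γ (k.1 + k.2) / ((k.1.factorial : ℂ) * (k.2.factorial : ℂ))

theorem appellF3Series_eq (α α' β β' γ x y : ℂ) :
    appellF3Series α α' β β' γ x y =
      ∑' k : ℕ × ℕ, appellF3Coeff α α' β β' γ k * (x ^ k.1 * y ^ k.2) :=
  tsum_congr fun k => by rw [appellF3Coeff]; ring

/-- The coefficients of the double series that Pfaff's transformation in the second variable makes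
of `F₃`. -/
noncomputable def appellF3PfaffCoeff (α α' β β' γ : ℂ) (k : ℕ × ℕ) : ℂ :=
  pochhammerC α k.1 * pochhammerC β k.1 * pochhammerC α' k.2 * pochhammerC (γ - β' + k.1) k.2 /
    pochhammerC γ (k.1 + k.2) / ((k.1.factorial : ℂ) * (k.2.factorial : ℂ))

theorem natCast_add_add_one_pow_le (i j p : ℕ) :
    ((i : ℝ) + j + 1) ^ p ≤ ((i : ℝ) + 1) ^ p * ((j : ℝ) + 1) ^ p := by
  rw [← mul_pow]
  gcongr
  nlinarith [mul_nonneg (Nat.cast_nonneg (α := ℝ) i) (Nat.cast_nonneg (α := ℝ) j)]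

theorem hasPolyGrowth_appellF3Coeff (α α' β β' : ℂ) {γ : ℂ} (hγ : 0 < γ.re) :
    HasPolyGrowth (appellF3Coeff α α' β β' γ) := by
  obtain ⟨A, hA, p, ha⟩ := exists_pochhammerC_le_pow α
  obtain ⟨A', hA', p', ha'⟩ := exists_pochhammerC_le_pow α'
  obtain ⟨B, hB, q, hb⟩ := exists_pochhammerC_le_pow β
  obtain ⟨B', hB', q', hb'⟩ := exists_pochhammerC_le_pow β'
  obtain ⟨D, hD, r, hd⟩ := exists_pochhammerC_inv_le_pow (ne_neg_natCast_of_re_pos hγ)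
  refine ⟨A * A' * B * B' * D, p + p' + q + q' + r, fun ⟨i, j⟩ => ?_⟩
  have hi : (0 : ℝ) < i.factorial := by positivity
  have hj : (0 : ℝ) < j.factorial := by positivity
  have hij : (0 : ℝ) < (i + j).factorial := by positivity
  have hf : (i.factorial : ℝ) * j.factorial ≤ (i + j).factorial := by
    exact_mod_cast Nat.le_of_dvd (Nat.factorial_pos _) (Nat.factorial_mul_factorial_dvd_factorial_add i j)
  have hd' := hd (i + j)
  push_cast at hd'
  have h1 : (1 : ℝ) ≤ (i : ℝ) + 1 := by simp
  have h2 : (1 : ℝ) ≤ (j : ℝ) + 1 := by simp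
  simp only [appellF3Coeff, norm_mul, norm_div, Complex.norm_natCast]
  rw [div_eq_mul_inv _ ‖pochhammerC γ (i + j)‖]
  calc _ ≤ (A * (i.factorial * ((i : ℝ) + 1) ^ p)) * (A' * (j.factorial * ((j : ℝ) + 1) ^ p')) *
        (B * (i.factorial * ((i : ℝ) + 1) ^ q)) * (B' * (j.factorial * ((j : ℝ) + 1) ^ q')) *
        (D * ((((i : ℝ) + 1) ^ r * ((j : ℝ) + 1) ^ r) / (i.factorial * j.factorial))) /
        (i.factorial * j.factorial) := by
        gcongr
        · exact ha i
        · exact ha' j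
        · exact hb i
        · exact hb' j
        · refine hd'.trans ?_
          gcongr
          exact natCast_add_add_one_pow_le i j r
    _ = A * A' * B * B' * D * (((i : ℝ) + 1) ^ (p + q + r) * ((j : ℝ) + 1) ^ (p' + q' + r)) := by
        field_simp
        ring
    _ ≤ _ := by
        exact mul_le_mul_of_nonneg_left (mul_le_mul (pow_le_pow_right₀ h1 (by lia))
          (pow_le_pow_right₀ h2 (by lia)) (by positivity) (by positivity)) (by positivity)

/-- The factor `(γ - β' + i)_j` is of size `(i + j)! / i!` up to polynomials, and `(γ)_{i + j}` in
the denominator cancels the `(i + j)!`. -/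
theorem hasPolyGrowth_appellF3PfaffCoeff (α α' β β' : ℂ) {γ : ℂ} (hγ : 0 < γ.re) :
    HasPolyGrowth (appellF3PfaffCoeff α α' β β' γ) := by
  obtain ⟨A, hA, p, ha⟩ := exists_pochhammerC_le_pow α
  obtain ⟨A', hA', p', ha'⟩ := exists_pochhammerC_le_pow α'
  obtain ⟨B, hB, q, hb⟩ := exists_pochhammerC_le_pow β
  obtain ⟨B', hB', q', hb'⟩ := exists_pochhammerC_add_le_pow (γ - β')
  obtain ⟨D, hD, r, hd⟩ := exists_pochhammerC_inv_le_pow (ne_neg_natCast_of_re_pos hγ)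
  refine ⟨A * A' * B * B' * D, p + p' + q + 2 * q' + r, fun ⟨i, j⟩ => ?_⟩
  have hi : (0 : ℝ) < i.factorial := by positivity
  have hj : (0 : ℝ) < j.factorial := by positivity
  have hij : (0 : ℝ) < (i + j).factorial := by positivity
  have hd' := hd (i + j)
  push_cast at hd'
  have h1 : (1 : ℝ) ≤ (i : ℝ) + 1 := by simp
  have h2 : (1 : ℝ) ≤ (j : ℝ) + 1 := by simp
  simp only [appellF3PfaffCoeff, norm_mul, norm_div, Complex.norm_natCast]
  rw [div_eq_mul_inv _ ‖pochhammerC γ (i + j)‖]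
  calc _ ≤ (A * (i.factorial * ((i : ℝ) + 1) ^ p)) * (B * (i.factorial * ((i : ℝ) + 1) ^ q)) *
        (A' * (j.factorial * ((j : ℝ) + 1) ^ p')) *
        (B' * ((i + j).factorial / i.factorial * (((i : ℝ) + 1) ^ q' *
          (((i : ℝ) + 1) ^ q' * ((j : ℝ) + 1) ^ q')))) *
        (D * ((((i : ℝ) + 1) ^ r * ((j : ℝ) + 1) ^ r) / (i + j).factorial)) /
        (i.factorial * j.factorial) := by
        gcongr
        · exact ha i
        · exact hb i
        · exact ha' j
        · refine (hb' i j).trans ?_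
          gcongr
          exact natCast_add_add_one_pow_le i j q'
        · refine hd'.trans ?_
          gcongr
          exact natCast_add_add_one_pow_le i j r
    _ = A * A' * B * B' * D *
        (((i : ℝ) + 1) ^ (p + q + 2 * q' + r) * ((j : ℝ) + 1) ^ (p' + q' + r)) := by
        field_simp
        ring
    _ ≤ _ := by
        exact mul_le_mul_of_nonneg_left (mul_le_mul (pow_le_pow_right₀ h1 (by lia))
          (pow_le_pow_right₀ h2 (by lia)) (by positivity) (by positivity)) (by positivity)

/-- The double series for `F₃(x; y)` in the half plane `Re y < 1 / 2`. -/
noncomputable def appellF3Pfaff (α α' β β' γ x y : ℂ) : ℂ :=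
  (1 - y) ^ (-α') *
    ∑' k : ℕ × ℕ, appellF3PfaffCoeff α α' β β' γ k * (x ^ k.1 * (y / (y - 1)) ^ k.2)

/-- The half plane consists of the points closer to `0` than to `1`. -/
theorem norm_div_sub_one_lt {y : ℂ} (hy : y.re < 1 / 2) : ‖y / (y - 1)‖ < 1 := by
  have h1 : y - 1 ≠ 0 := fun h => by
    have := congrArg Complex.re h
    simp at this
    linarith
  rw [norm_div, div_lt_one (norm_pos_iff.2 h1), ← sq_lt_sq₀ (norm_nonneg _) (norm_nonneg _),
    ← Complex.normSq_eq_norm_sq, ← Complex.normSq_eq_norm_sq, Complex.normSq_apply,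
    Complex.normSq_apply]
  simp
  nlinarith

theorem differentiableOn_appellF3Pfaff (α α' β β' : ℂ) {γ x : ℂ} (hγ : 0 < γ.re) (hx : ‖x‖ < 1) :
    DifferentiableOn ℂ (appellF3Pfaff α α' β β' γ x) {y | y.re < 1 / 2} := by
  refine DifferentiableOn.mul ?_ ?_
  · refine DifferentiableOn.cpow_const (by fun_prop) fun y hy => Or.inl ?_
    simp only [Set.mem_ofPred_eq] at hy
    simp only [Complex.sub_re, Complex.one_re]
    linarith
  · refine ((hasPolyGrowth_appellF3PfaffCoeff α α' β β' hγ).differentiableOn hx).comp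
      (t := Metric.ball 0 1) (g := fun w : ℂ => ∑' k : ℕ × ℕ, appellF3PfaffCoeff α α' β β' γ k *
        (x ^ k.1 * w ^ k.2)) (f := fun y : ℂ => y / (y - 1)) ?_ fun y hy => ?_
    · refine DifferentiableOn.div (by fun_prop) (by fun_prop) fun y hy h => ?_
      have := congrArg Complex.re h
      simp at this hy
      linarith
    · rw [mem_ball_zero_iff]
      exact norm_div_sub_one_lt hy

theorem differentiableOn_appellF3Series (α α' β β' : ℂ) {γ x : ℂ} (hγ : 0 < γ.re) (hx : ‖x‖ < 1) :
    DifferentiableOn ℂ (appellF3Series α α' β β' γ x) (Metric.ball 0 1) := by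
  have := (hasPolyGrowth_appellF3Coeff α α' β β' hγ).differentiableOn hx
  exact this.congr fun y _ => appellF3Series_eq α α' β β' γ x y

/-- For each fixed `k`, Pfaff's transformation applies to the sum over the second index, with lower
parameter `γ + k`. -/
theorem appellF3Series_eq_pfaff_of_norm_lt (α α' β β' : ℂ) {γ x y : ℂ} (hγ : 0 < γ.re)
    (hx : ‖x‖ < 1) (hy : ‖y‖ < 1 / 2) :
    appellF3Series α α' β β' γ x y = appellF3Pfaff α α' β β' γ x y := by
  have hy1 : ‖y‖ < 1 := by linarith
  have hy2 : y.re < 1 / 2 := (Complex.re_le_norm y).trans_lt hy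
  have s1 := ((hasPolyGrowth_appellF3Coeff α α' β β' hγ).summable_norm hx hy1).of_norm
  have s2 := ((hasPolyGrowth_appellF3PfaffCoeff α α' β β' hγ).summable_norm hx
    (norm_div_sub_one_lt hy2)).of_norm
  have hg0 := pochhammerC_ne_zero (ne_neg_natCast_of_re_pos hγ)
  rw [appellF3Series_eq, appellF3Pfaff, s1.tsum_prod' s1.prod_factor, s2.tsum_prod' s2.prod_factor,
    ← tsum_mul_left]
  refine tsum_congr fun k => ?_
  have hγk : 0 < (γ + k).re := by
    simp only [Complex.add_re, Complex.natCast_re]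
    positivity
  have hn := ne_neg_natCast_of_re_pos hγk
  have hp := pfaff_transformation α' β' hn hy
  set K : ℂ := pochhammerC α k * pochhammerC β k / pochhammerC γ k / k.factorial * x ^ k
  have e1 : ∀ l : ℕ, appellF3Coeff α α' β β' γ (k, l) * (x ^ k * y ^ l) =
      K * (pochhammerC α' l * pochhammerC β' l / pochhammerC (γ + k) l * (y ^ l / l.factorial)) := by
    intro l
    simp only [appellF3Coeff, K]
    rw [pochhammerC_add]
    ring
  have e2 : ∀ l : ℕ, appellF3PfaffCoeff α α' β β' γ (k, l) * (x ^ k * (y / (y - 1)) ^ l) =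
      K * (pochhammerC α' l * pochhammerC (γ + k - β') l / pochhammerC (γ + k) l *
        ((y / (y - 1)) ^ l / l.factorial)) := by
    intro l
    simp only [appellF3PfaffCoeff, K]
    rw [pochhammerC_add, show γ - β' + k = γ + k - β' by ring]
    ring
  simp only [e1, e2]
  rw [tsum_mul_left, tsum_mul_left, hp]
  ring

theorem isOpen_re_lt_half : IsOpen {y : ℂ | y.re < 1 / 2} :=
  isOpen_lt Complex.continuous_re continuous_const

theorem convex_re_lt_half : Convex ℝ {y : ℂ | y.re < 1 / 2} :=
  convex_halfSpace_re_lt _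

/-- Identity theorem on the convex intersection of disc and half plane, starting from a
neighbourhood of `0`. -/
theorem appellF3Series_eq_pfaff (α α' β β' : ℂ) {γ x y : ℂ} (hγ : 0 < γ.re)
    (hx : ‖x‖ < 1) (hy : ‖y‖ < 1) (hy2 : y.re < 1 / 2) :
    appellF3Series α α' β β' γ x y = appellF3Pfaff α α' β β' γ x y := by
  have ho : IsOpen (Metric.ball (0 : ℂ) 1 ∩ {y : ℂ | y.re < 1 / 2}) :=
    Metric.isOpen_ball.inter isOpen_re_lt_half
  refine AnalyticOnNhd.eqOn_of_preconnected_of_eventuallyEq (𝕜 := ℂ) (z₀ := 0)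
    (((differentiableOn_appellF3Series α α' β β' hγ hx).mono Set.inter_subset_left).analyticOnNhd ho)
    (((differentiableOn_appellF3Pfaff α α' β β' hγ hx).mono Set.inter_subset_right).analyticOnNhd ho)
    ((convex_ball 0 1).inter convex_re_lt_half).isPreconnected (by simp) ?_ ⟨by simpa using hy, hy2⟩
  filter_upwards [Metric.ball_mem_nhds (0 : ℂ) (by norm_num : (0 : ℝ) < 1 / 2)] with w hw
  exact appellF3Series_eq_pfaff_of_norm_lt α α' β β' hγ hx (by simpa using hw)

theorem isOpen_appellF3Domain : IsOpen appellF3Domain :=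
  Metric.isOpen_ball.union isOpen_re_lt_half

theorem isPreconnected_appellF3Domain : IsPreconnected appellF3Domain :=
  IsPreconnected.union 0 (by simp) (by simp) (convex_ball 0 1).isPreconnected
    convex_re_lt_half.isPreconnected

theorem IsAppellF3Continuation.eqOn {α α' β β' γ x : ℂ} {g h : ℂ → ℂ}
    (hg : IsAppellF3Continuation α α' β β' γ x g) (hh : IsAppellF3Continuation α α' β β' γ x h) :
    Set.EqOn g h appellF3Domain := by
  refine AnalyticOnNhd.eqOn_of_preconnected_of_eventuallyEq (𝕜 := ℂ) (z₀ := 0)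
    (hg.1.analyticOnNhd isOpen_appellF3Domain) (hh.1.analyticOnNhd isOpen_appellF3Domain)
    isPreconnected_appellF3Domain (Or.inl (by simp)) ?_
  filter_upwards [Metric.ball_mem_nhds (0 : ℂ) one_pos] with w hw
  rw [mem_ball_zero_iff] at hw
  rw [hg.2 w hw, hh.2 w hw]

/-- The power series on the disc and the Pfaff series on the half plane agree on the overlap and are
glued. -/
theorem exists_isAppellF3Continuation (α α' β β' : ℂ) {γ x : ℂ} (hγ : 0 < γ.re) (hx : ‖x‖ < 1) :
    ∃ g, IsAppellF3Continuation α α' β β' γ x g ∧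
      ∀ y : ℂ, y.re < 1 / 2 → g y = appellF3Pfaff α α' β β' γ x y := by
  classical
  set g : ℂ → ℂ := fun y => if ‖y‖ < 1 then appellF3Series α α' β β' γ x y else
    appellF3Pfaff α α' β β' γ x y with hg
  have h1 : ∀ y : ℂ, ‖y‖ < 1 → g y = appellF3Series α α' β β' γ x y := fun y hy => if_pos hy
  have h2 : ∀ y : ℂ, y.re < 1 / 2 → g y = appellF3Pfaff α α' β β' γ x y := by
    intro y hy
    by_cases h : ‖y‖ < 1
    · rw [h1 y h, appellF3Series_eq_pfaff α α' β β' hγ hx h hy]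
    · exact if_neg h
  refine ⟨g, ⟨?_, h1⟩, h2⟩
  rintro y (hy | hy)
  · have h3 : DifferentiableOn ℂ g (Metric.ball 0 1) :=
      (differentiableOn_appellF3Series α α' β β' hγ hx).congr fun y hy =>
        h1 y (by simpa using hy)
    exact (h3.differentiableAt (Metric.isOpen_ball.mem_nhds hy)).differentiableWithinAt
  · have h3 : DifferentiableOn ℂ g {y : ℂ | y.re < 1 / 2} :=
      (differentiableOn_appellF3Pfaff α α' β β' hγ hx).congr h2
    exact (h3.differentiableAt (isOpen_re_lt_half.mem_nhds hy)).differentiableWithinAt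

theorem isAppellF3Continuation_appellF3 (α α' β β' : ℂ) {γ x : ℂ} (hγ : 0 < γ.re) (hx : ‖x‖ < 1) :
    IsAppellF3Continuation α α' β β' γ x (appellF3 α α' β β' γ x) := by
  obtain ⟨g, hg, -⟩ := exists_isAppellF3Continuation α α' β β' hγ hx
  have h : ∃ g, IsAppellF3Continuation α α' β β' γ x g := ⟨g, hg⟩
  have he : appellF3 α α' β β' γ x = h.choose := by
    ext y
    rw [appellF3, dif_pos h]
  rw [he]
  exact h.choose_spec

/-- Uniqueness of the continuation makes the choice in the definition of `appellF3` harmless and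
gives a series usable on all of `(-∞, 0]`. -/
theorem appellF3_eq_pfaff (α α' β β' : ℂ) {γ x y : ℂ} (hγ : 0 < γ.re) (hx : ‖x‖ < 1)
    (hy : y.re < 1 / 2) : appellF3 α α' β β' γ x y = appellF3Pfaff α α' β β' γ x y := by
  obtain ⟨g, hg, hp⟩ := exists_isAppellF3Continuation α α' β β' hγ hx
  rw [← hp y hy]
  exact (isAppellF3Continuation_appellF3 α α' β β' hγ hx).eqOn hg (Or.inr hy)

/-! ### Contiguous relation for `F₃` -/

theorem appellF3Series_contiguous (α α' β β' : ℂ) {γ x y : ℂ} (hγ : 0 < γ.re) (hx : ‖x‖ < 1)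
    (hy : ‖y‖ < 1) :
    appellF3Series α α' β β' γ x y = appellF3Series α (α' + 1) β β' γ x y -
      β' / γ * y * appellF3Series α (α' + 1) β (β' + 1) (γ + 1) x y := by
  have hγ1 : 0 < (γ + 1).re := by
    simp only [Complex.add_re, Complex.one_re]
    positivity
  have s1 := ((hasPolyGrowth_appellF3Coeff α α' β β' hγ).summable_norm hx hy).of_norm
  have s2 := ((hasPolyGrowth_appellF3Coeff α (α' + 1) β β' hγ).summable_norm hx hy).of_norm
  have s3 := ((hasPolyGrowth_appellF3Coeff α (α' + 1) β (β' + 1) hγ1).summable_norm hx hy).of_norm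
  have hγ0 : γ ≠ 0 := fun h => by simp [h] at hγ
  rw [eq_sub_iff_add_eq', ← eq_sub_iff_add_eq, appellF3Series_eq, appellF3Series_eq,
    appellF3Series_eq, ← s2.tsum_sub s1, (s2.sub s1).tsum_prod' (s2.sub s1).prod_factor,
    s3.tsum_prod' s3.prod_factor, ← tsum_mul_left]
  refine tsum_congr fun k => ?_
  -- Changing `α'` does not affect the term `l = 0`, so it cancels; the index shift then supplies
  -- the factor `y`.
  rw [((s2.sub s1).prod_factor k).tsum_eq_zero_add, ← tsum_mul_left]
  simp only [appellF3Coeff, pochhammerC_zero]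
  simp only [Nat.factorial_zero, Nat.cast_one, add_zero, sub_self, zero_add]
  refine (tsum_congr fun l => ?_).symm
  have hl : (l.factorial : ℂ) ≠ 0 := by exact_mod_cast l.factorial_ne_zero
  have hl1 : (l : ℂ) + 1 ≠ 0 := by exact_mod_cast l.succ_ne_zero
  have hk : (k.factorial : ℂ) ≠ 0 := by exact_mod_cast k.factorial_ne_zero
  have hp := pochhammerC_ne_zero (ne_neg_natCast_of_re_pos hγ1) (k + l)
  rw [pochhammerC_succ_left β', pochhammerC_succ_left α', pochhammerC_succ (α' + 1), ← add_assoc,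
    pochhammerC_succ_left γ, Nat.factorial_succ]
  push_cast
  field_simp
  ring

/-- The contiguous relation that raises the second parameter of `F₃`. -/
theorem appellF3_contiguous (α α' β β' : ℂ) {γ x y : ℂ} (hγ : 0 < γ.re) (hx : ‖x‖ < 1)
    (hy : y.re < 1 / 2) :
    appellF3 α α' β β' γ x y = appellF3 α (α' + 1) β β' γ x y -
      β' / γ * y * appellF3 α (α' + 1) β (β' + 1) (γ + 1) x y := by
  have hγ1 : 0 < (γ + 1).re := by
    simp only [Complex.add_re, Complex.one_re]
    positivity
  have h1 := isAppellF3Continuation_appellF3 α α' β β' hγ hx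
  have h2 := isAppellF3Continuation_appellF3 α (α' + 1) β β' hγ hx
  have h3 := isAppellF3Continuation_appellF3 α (α' + 1) β (β' + 1) hγ1 hx
  refine h1.eqOn (h := fun y => appellF3 α (α' + 1) β β' γ x y -
      β' / γ * y * appellF3 α (α' + 1) β (β' + 1) (γ + 1) x y) ⟨?_, fun w hw => ?_⟩ (Or.inr hy)
  · exact h2.1.sub (DifferentiableOn.mul (by fun_prop) h3.1)
  · simp only
    rw [h2.2 w hw, h3.2 w hw, ← appellF3Series_contiguous α α' β β' hγ hx hw]

/-! ### Termwise integration and beta integrals -/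

theorem integrable_and_hasSum_of_summable_integral_norm {X ι : Type*} [MeasurableSpace X]
    {μ : Measure X} [Countable ι] {F : ι → X → ℂ} {f : X → ℂ} (hF : ∀ i, Integrable (F i) μ)
    (hs : Summable fun i => ∫ a, ‖F i a‖ ∂μ) (hf : ∀ᵐ a ∂μ, HasSum (fun i => F i a) (f a)) :
    Integrable f μ ∧ HasSum (fun i => ∫ a, F i a ∂μ) (∫ a, f a ∂μ) := by
  have he : f =ᵐ[μ] fun a => ∑' i, F i a := hf.mono fun a ha => ha.tsum_eq.symm
  refine ⟨⟨?_, ?_⟩, ?_⟩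
  · exact aestronglyMeasurable_of_tendsto_ae (u := (atTop : Filter (Finset ι)))
      (f := fun s a => ∑ i ∈ s, F i a)
      (fun s => Finset.aestronglyMeasurable_fun_sum s fun i _ => (hF i).1) hf
  · have h1 : ∫⁻ a, ‖f a‖ₑ ∂μ ≤ ∫⁻ a, ∑' i, ‖F i a‖ₑ ∂μ := by
      refine lintegral_mono_ae (he.mono fun a ha => ?_)
      rw [ha]
      exact enorm_tsum_le_tsum_enorm
    refine h1.trans_lt ?_
    rw [lintegral_tsum fun i => (hF i).1.enorm]
    have h2 : ∀ i, ∫⁻ a, ‖F i a‖ₑ ∂μ = ENNReal.ofReal (∫ a, ‖F i a‖ ∂μ) := fun i => by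
      rw [ofReal_integral_norm_eq_lintegral_enorm (hF i)]
    simp only [h2]
    exact hs.tsum_ofReal_lt_top
  · rw [integral_congr_ae he]
    exact hasSum_integral_of_summable_integral_norm hF hs

theorem integrableOn_beta {s t : ℂ} (hs : 0 < s.re) (ht : 0 < t.re) :
    IntegrableOn (fun u : ℝ => (u : ℂ) ^ (s - 1) * (1 - (u : ℂ)) ^ (t - 1)) (Set.Ioo 0 1) := by
  have := Complex.betaIntegral_convergent hs ht
  rw [intervalIntegrable_iff_integrableOn_Ioc_of_le zero_le_one] at this
  exact this.mono_set Set.Ioo_subset_Ioc_self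

theorem setIntegral_beta {s t : ℂ} (hs : 0 < s.re) (ht : 0 < t.re) :
    ∫ u in Set.Ioo (0 : ℝ) 1, (u : ℂ) ^ (s - 1) * (1 - (u : ℂ)) ^ (t - 1) =
      Complex.Gamma s * Complex.Gamma t * (Complex.Gamma (s + t))⁻¹ := by
  have h1 := Complex.Gamma_mul_Gamma_eq_betaIntegral hs ht
  have h2 : Complex.Gamma (s + t) ≠ 0 :=
    Complex.Gamma_ne_zero_of_re_pos (by simp only [Complex.add_re]; positivity)
  rw [← integral_Ioc_eq_integral_Ioo, ← intervalIntegral.integral_of_le zero_le_one, h1,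
    Complex.betaIntegral]
  field_simp

theorem norm_beta_integrand (s t : ℂ) {u : ℝ} (hu : u ∈ Set.Ioo (0 : ℝ) 1) :
    ((‖(u : ℂ) ^ (s - 1) * (1 - (u : ℂ)) ^ (t - 1)‖ : ℝ) : ℂ) =
      (u : ℂ) ^ ((s.re : ℂ) - 1) * (1 - (u : ℂ)) ^ ((t.re : ℂ) - 1) := by
  have h1 : 0 < 1 - u := by linarith [hu.2]
  rw [norm_mul, Complex.norm_cpow_eq_rpow_re_of_pos hu.1,
    show (1 : ℂ) - u = ((1 - u : ℝ) : ℂ) by push_cast; rfl,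
    Complex.norm_cpow_eq_rpow_re_of_pos h1, Complex.ofReal_mul, Complex.ofReal_cpow hu.1.le,
    Complex.ofReal_cpow h1.le]
  simp

/-- The norm of a beta integrand is the beta integrand at the real parts of the parameters. The
outer norm on the right avoids a separate discussion of signs. -/
theorem setIntegral_norm_beta {s t : ℂ} (hs : 0 < s.re) (ht : 0 < t.re) :
    ∫ u in Set.Ioo (0 : ℝ) 1, ‖(u : ℂ) ^ (s - 1) * (1 - (u : ℂ)) ^ (t - 1)‖ =
      ‖Complex.Gamma s.re * Complex.Gamma t.re * (Complex.Gamma (s.re + t.re))⁻¹‖ := by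
  rw [← setIntegral_beta (by simpa using hs) (by simpa using ht),
    ← setIntegral_congr_fun measurableSet_Ioo fun u hu => norm_beta_integrand s t hu,
    integral_complex_ofReal, Complex.norm_real, Real.norm_of_nonneg]
  exact integral_nonneg fun _ => norm_nonneg _

theorem summable_rpow_prod {E A H : ℝ} (hA : 0 < A) (h1 : A < H) (h2 : A + E < H) :
    Summable fun k : ℕ × ℕ => ((k.1 : ℝ) + 1) ^ (E - 1) * ((k.2 : ℝ) + 1) ^ (A - 1) *
      ((k.1 : ℝ) + k.2 + 1) ^ (-H) := by
  set M := max E 0 with hM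
  have hM1 : E ≤ M := le_max_left _ _
  have hM0 : 0 ≤ M := le_max_right _ _
  have hMH : A + M < H := by
    rcases max_choice E 0 with h | h <;> rw [hM, h] <;> linarith
  -- The slack in `A + M < H` is halved so that `H = (M + ε) + (A + ε)`; each index receives one
  -- part, since `i + j + 1` is at least `i + 1` and `j + 1`.
  set ε := (H - A - M) / 2 with hε
  have hε0 : 0 < ε := by rw [hε]; linarith
  have hs := (summable_natCast_add_one_rpow (s := E - 1 - (M + ε)) (by linarith)).mul_of_nonneg
    (summable_natCast_add_one_rpow (s := A - 1 - (A + ε)) (by linarith))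
    (fun _ => by positivity) fun _ => by positivity
  refine Summable.of_nonneg_of_le (fun _ => by positivity) (fun ⟨i, j⟩ => ?_) hs
  have hi : (0 : ℝ) < (i : ℝ) + 1 := by positivity
  have hj : (0 : ℝ) < (j : ℝ) + 1 := by positivity
  have hij : (0 : ℝ) < (i : ℝ) + j + 1 := by positivity
  have e1 : ((i : ℝ) + j + 1) ^ (-H) ≤ ((i : ℝ) + 1) ^ (-(M + ε)) * ((j : ℝ) + 1) ^ (-(A + ε)) := by
    rw [show -H = -(M + ε) + -(A + ε) by rw [hε]; ring, Real.rpow_add hij]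
    gcongr ?_ * ?_
    · exact Real.rpow_le_rpow_of_nonpos hi (by simp) (by linarith)
    · exact Real.rpow_le_rpow_of_nonpos hj (by simp) (by linarith)
  simp only
  rw [sub_eq_add_neg (E - 1), sub_eq_add_neg (A - 1), Real.rpow_add hi, Real.rpow_add hj]
  calc _ ≤ ((i : ℝ) + 1) ^ (E - 1) * ((j : ℝ) + 1) ^ (A - 1) *
        (((i : ℝ) + 1) ^ (-(M + ε)) * ((j : ℝ) + 1) ^ (-(A + ε))) := by gcongr
    _ = _ := by ring

theorem exists_norm_beta_add_le {r d : ℝ} (hr : 0 < r) (hd : 0 < d) :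
    ∃ C : ℝ, 0 < C ∧ ∀ n : ℕ, ‖Complex.Gamma ((r : ℂ) + n) * Complex.Gamma d *
      (Complex.Gamma ((r : ℂ) + n + d))⁻¹‖ ≤ C * ((n : ℝ) + 1) ^ (-d) := by
  have hr' : 0 < (r : ℂ).re := by simpa using hr
  obtain ⟨A, hA, ha⟩ := exists_pochhammerC_le (r : ℂ)
  obtain ⟨B, hB, hb⟩ := exists_Gamma_inv_le ((r : ℂ) + d)
  have hG : 0 < ‖Complex.Gamma (r : ℂ)‖ := norm_pos_iff.2 (Complex.Gamma_ne_zero_of_re_pos hr')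
  have hG2 : 0 < ‖Complex.Gamma (d : ℂ)‖ :=
    norm_pos_iff.2 (Complex.Gamma_ne_zero_of_re_pos (by simpa using hd))
  refine ⟨‖Complex.Gamma (r : ℂ)‖ * A * ‖Complex.Gamma (d : ℂ)‖ * B, by positivity, fun n => ?_⟩
  rw [Gamma_add_natCast (ne_neg_natCast_of_re_pos hr'), show (r : ℂ) + n + d = r + d + n by ring,
    norm_mul, norm_mul, norm_mul]
  calc _ ≤ ‖Complex.Gamma (r : ℂ)‖ * (A * pochhammerGrowth r n) * ‖Complex.Gamma (d : ℂ)‖ *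
        (B / pochhammerGrowth (r + d) n) := by
        have := pochhammerGrowth_pos r n
        gcongr
        · exact ha n
        · simpa using hb n
    _ = _ := by
        have hn : (0 : ℝ) < (n : ℝ) + 1 := by positivity
        have h : ((n : ℝ) + 1) ^ (r - 1) = ((n : ℝ) + 1) ^ (-d) * ((n : ℝ) + 1) ^ (r + d - 1) := by
          rw [← Real.rpow_add hn]; ring_nf
        have h2 : ((n : ℝ) + 1) ^ (r + d - 1) ≠ 0 := by positivity
        have hf : (n.factorial : ℝ) ≠ 0 := by positivity
        unfold pochhammerGrowth
        rw [h]
        field_simp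

/-- After integration up to `u = 1` no geometric decay is left, so the exact exponents are needed
here. -/
theorem exists_norm_appellF3PfaffCoeff_le (α α' β β' : ℂ) {γ : ℂ} (hγ : 0 < γ.re) :
    ∃ C : ℝ, 0 < C ∧ ∀ k : ℕ × ℕ, ‖appellF3PfaffCoeff α α' β β' γ k‖ ≤
      C * (((k.1 : ℝ) + 1) ^ ((α + β - γ + β').re - 1) * ((k.2 : ℝ) + 1) ^ (α'.re - 1) *
        ((k.1 : ℝ) + k.2 + 1) ^ (-β'.re)) := by
  obtain ⟨A, hA, ha⟩ := exists_pochhammerC_le α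
  obtain ⟨A', hA', ha'⟩ := exists_pochhammerC_le α'
  obtain ⟨B, hB, hb⟩ := exists_pochhammerC_le β
  obtain ⟨B', hB', hb'⟩ := exists_pochhammerC_add_le (γ - β')
  obtain ⟨D, hD, hd⟩ := exists_pochhammerC_bounds (ne_neg_natCast_of_re_pos hγ)
  refine ⟨A * B * A' * B' * D, by positivity, fun ⟨i, j⟩ => ?_⟩
  have hg : ∀ x n, 0 < pochhammerGrowth x n := pochhammerGrowth_pos
  have g1 := hg α.re i
  have g2 := hg β.re i
  have g3 := hg α'.re j
  have g4 := hg (γ - β').re i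
  have g5 := hg (γ - β').re (i + j)
  have g6 := hg γ.re (i + j)
  have hp := norm_pos_iff.2 (pochhammerC_ne_zero (ne_neg_natCast_of_re_pos hγ) (i + j))
  have hd' : ‖pochhammerC γ (i + j)‖⁻¹ ≤ D / pochhammerGrowth γ.re (i + j) := by
    rw [inv_eq_one_div, div_le_div_iff₀ hp g6, one_mul]
    exact (hd (i + j)).2
  simp only [appellF3PfaffCoeff, norm_mul, norm_div, Complex.norm_natCast]
  rw [div_eq_mul_inv _ ‖pochhammerC γ (i + j)‖]
  calc _ ≤ (A * pochhammerGrowth α.re i) * (B * pochhammerGrowth β.re i) *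
        (A' * pochhammerGrowth α'.re j) * (B' * (pochhammerGrowth (γ - β').re (i + j) /
          pochhammerGrowth (γ - β').re i)) * (D / pochhammerGrowth γ.re (i + j)) /
        (i.factorial * j.factorial) := by
        gcongr
        · exact ha i
        · exact hb i
        · exact ha' j
        · exact hb' i j
    _ = A * B * A' * B' * D * ((pochhammerGrowth α.re i * pochhammerGrowth β.re i / i.factorial /
          pochhammerGrowth (γ - β').re i) * (pochhammerGrowth α'.re j / j.factorial) *
          (pochhammerGrowth (γ - β').re (i + j) / pochhammerGrowth γ.re (i + j))) := by
        ring
    _ = _ := by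
        have hn : (0 : ℝ) < ((i + j : ℕ) : ℝ) + 1 := by positivity
        have hf : ((i + j).factorial : ℝ) ≠ 0 := by positivity
        have hfj : (j.factorial : ℝ) ≠ 0 := by positivity
        have e1 : pochhammerGrowth (γ - β').re (i + j) / pochhammerGrowth γ.re (i + j) =
            ((i : ℝ) + j + 1) ^ (-β'.re) := by
          have h2 : (((i + j : ℕ) : ℝ) + 1) ^ (γ.re - 1) ≠ 0 := by positivity
          unfold pochhammerGrowth
          rw [mul_div_mul_left _ _ hf, div_eq_iff h2, ← Nat.cast_add, ← Real.rpow_add hn,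
            Complex.sub_re]
          ring_nf
        have e2 : pochhammerGrowth α'.re j / j.factorial = ((j : ℝ) + 1) ^ (α'.re - 1) := by
          unfold pochhammerGrowth
          field_simp
        rw [pochhammerGrowth_mul_div, e1, e2]
        simp only [Complex.add_re, Complex.sub_re]
        ring_nf

/-! ### Mellin transform of the kernel -/

/-- The kernel of the Marichev-Saigo-Maeda integral of a power, in the variable `u = 1 - x / t`. -/
noncomputable def msmUnitKernel (α α' β β' γ σ : ℂ) (u : ℝ) : ℂ :=
  (u : ℂ) ^ (γ - 1) * (1 - (u : ℂ)) ^ (σ + α - γ - 1) *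
    appellF3 α α' β β' γ (u : ℂ) (-((u : ℂ) / (1 - u)))

/-- The value of the Mellin transform of `msmUnitKernel`. -/
noncomputable def msmGammaRatio (α α' β β' γ σ : ℂ) : ℂ :=
  Complex.Gamma (σ - β) * Complex.Gamma (σ + α + α' - γ) * Complex.Gamma (σ + α + β' - γ) /
    (Complex.Gamma σ * Complex.Gamma (σ + α - β) * Complex.Gamma (σ + α + α' + β' - γ))

/-- At `y = -u / (1 - u)` one has `y / (y - 1) = u` and `1 - y = (1 - u)⁻¹`, so each term of the
Pfaff series becomes a beta integrand. -/
theorem msmUnitKernel_eq_tsum (α α' β β' : ℂ) {γ : ℂ} (σ : ℂ) (hγ : 0 < γ.re) {u : ℝ}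
    (hu : u ∈ Set.Ioo (0 : ℝ) 1) :
    HasSum (fun k : ℕ × ℕ => appellF3PfaffCoeff α α' β β' γ k *
      ((u : ℂ) ^ (γ + (k.1 + k.2 : ℕ) - 1) * (1 - (u : ℂ)) ^ (σ + α + α' - γ - 1)))
      (msmUnitKernel α α' β β' γ σ u) := by
  have h1 : 0 < 1 - u := by linarith [hu.2]
  have hu0 : (u : ℂ) ≠ 0 := by exact_mod_cast hu.1.ne'
  have hu1 : (1 : ℂ) - u ≠ 0 := by exact_mod_cast h1.ne'
  have hx : ‖(u : ℂ)‖ < 1 := by rw [Complex.norm_real, Real.norm_of_nonneg hu.1.le]; exact hu.2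
  have hy : (-((u : ℂ) / (1 - u))).re < 1 / 2 := by
    rw [show -((u : ℂ) / (1 - u)) = ((-(u / (1 - u)) : ℝ) : ℂ) by push_cast; rfl, Complex.ofReal_re]
    have : 0 < u / (1 - u) := div_pos hu.1 h1
    linarith
  have e1 : (1 : ℂ) - -((u : ℂ) / (1 - u)) = (1 - (u : ℂ))⁻¹ := by field_simp; ring
  have e2 : -((u : ℂ) / (1 - u)) / (-((u : ℂ) / (1 - u)) - 1) = u := by
    have : -((u : ℂ) / (1 - u)) - 1 = -(1 - (u : ℂ))⁻¹ := by rw [← e1]; ring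
    rw [this]
    field_simp
  have e3 : ((1 - u : ℂ)⁻¹) ^ (-α') = (1 - u : ℂ) ^ α' := by
    rw [show (1 : ℂ) - u = ((1 - u : ℝ) : ℂ) by push_cast; rfl, Complex.inv_cpow, Complex.cpow_neg,
      inv_inv]
    rw [Complex.arg_ofReal_of_nonneg h1.le]
    exact Real.pi_pos.ne
  have hs := ((hasPolyGrowth_appellF3PfaffCoeff α α' β β' hγ).summable_norm hx hx).of_norm.hasSum
  rw [msmUnitKernel, appellF3_eq_pfaff α α' β β' hγ hx hy, appellF3Pfaff, e1, e2, e3]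
  have e4 : ∀ k : ℕ × ℕ, appellF3PfaffCoeff α α' β β' γ k *
      ((u : ℂ) ^ (γ + (k.1 + k.2 : ℕ) - 1) * (1 - (u : ℂ)) ^ (σ + α + α' - γ - 1)) =
      ((u : ℂ) ^ (γ - 1) * (1 - (u : ℂ)) ^ (σ + α - γ - 1) * (1 - u : ℂ) ^ α') *
        (appellF3PfaffCoeff α α' β β' γ k * ((u : ℂ) ^ k.1 * (u : ℂ) ^ k.2)) := by
    intro k
    rw [show γ + (k.1 + k.2 : ℕ) - 1 = γ - 1 + (k.1 + k.2 : ℕ) by ring, Complex.cpow_add _ _ hu0,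
      Complex.cpow_natCast, show σ + α + α' - γ - 1 = (σ + α - γ - 1) + α' by ring,
      Complex.cpow_add _ _ hu1, pow_add]
    ring
  simp only [e4]
  rw [← mul_assoc]
  exact hs.mul_left _

/-- The sum over `j` is a Gauss sum whose value depends on `i` only through `1 / Γ(σ + α + i)`, so
the sum over `i` is again a Gauss sum. The two positivity conditions `hQ` and `hβ` are the
respective convergence conditions. -/
theorem hasSum_gauss_gauss {α α' β β' γ σ : ℂ} (hγ : 0 < γ.re)
    (hβ : 0 < (σ - β).re) (hQ : 0 < (σ + α + β' - γ).re) {S : ℂ}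
    (hS : HasSum (fun k : ℕ × ℕ => appellF3PfaffCoeff α α' β β' γ k *
      (Complex.Gamma (γ + (k.1 + k.2 : ℕ)) * Complex.Gamma (σ + α + α' - γ) *
        (Complex.Gamma (γ + (k.1 + k.2 : ℕ) + (σ + α + α' - γ)))⁻¹)) S) :
    S = Complex.Gamma γ * msmGammaRatio α α' β β' γ σ := by
  have hn := ne_neg_natCast_of_re_pos hγ
  set D := Complex.Gamma (σ + α + α' - γ) with hD
  have e1 : ∀ i j : ℕ, appellF3PfaffCoeff α α' β β' γ (i, j) *
      (Complex.Gamma (γ + (i + j : ℕ)) * D *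
        (Complex.Gamma (γ + (i + j : ℕ) + (σ + α + α' - γ)))⁻¹) =
      Complex.Gamma γ * D * (pochhammerC α i * pochhammerC β i / i.factorial) *
        gaussTerm α' (γ - β' + i) (σ + α + α' + i) j := by
    intro i j
    have hp := pochhammerC_ne_zero hn (i + j)
    rw [appellF3PfaffCoeff, gaussTerm, Gamma_add_natCast hn,
      show γ + (i + j : ℕ) + (σ + α + α' - γ) = σ + α + α' + i + j by push_cast; ring]
    field_simp
  have e2 : ∀ i : ℕ, ∑' j, gaussTerm α' (γ - β' + i) (σ + α + α' + i) j =
      Complex.Gamma (σ + α + β' - γ) / Complex.Gamma (σ + α + α' + β' - γ) *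
        (Complex.Gamma (σ + α + i))⁻¹ := by
    intro i
    have h := tsum_gaussTerm (a := α') (b := γ - β' + i) (c := σ + α + α' + i)
    rw [show σ + α + α' + i - α' - (γ - β' + i) = σ + α + β' - γ by ring,
      show σ + α + α' + i - α' = σ + α + i by ring,
      show σ + α + α' + i - (γ - β' + i) = σ + α + α' + β' - γ by ring] at h
    rw [h hQ]
    ring
  have h3 := tsum_gaussTerm (a := α) (b := β) (c := σ + α)
  rw [show σ + α - α - β = σ - β by ring, show σ + α - α = σ by ring] at h3
  rw [← hS.tsum_eq, hS.summable.tsum_prod' hS.summable.prod_factor]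
  simp only [e1, tsum_mul_left, e2]
  have e3 : ∀ i : ℕ, Complex.Gamma γ * D * (pochhammerC α i * pochhammerC β i / i.factorial) *
      (Complex.Gamma (σ + α + β' - γ) / Complex.Gamma (σ + α + α' + β' - γ) *
        (Complex.Gamma (σ + α + i))⁻¹) =
      Complex.Gamma γ * D * (Complex.Gamma (σ + α + β' - γ) /
        Complex.Gamma (σ + α + α' + β' - γ)) * gaussTerm α β (σ + α) i := by
    intro i
    rw [gaussTerm]
    ring
  simp only [e3, tsum_mul_left]
  rw [h3 hβ, msmGammaRatio]
  ring

theorem msmUnitKernel_integral_of_re_pos {α α' β β' γ σ : ℂ} (hγ : 0 < γ.re) (hα' : 0 < α'.re)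
    (hβ : 0 < (σ - β).re) (hP : 0 < (σ + α + α' - γ).re) (hQ : 0 < (σ + α + β' - γ).re) :
    IntegrableOn (msmUnitKernel α α' β β' γ σ) (Set.Ioo 0 1) ∧
      ∫ u in Set.Ioo (0 : ℝ) 1, msmUnitKernel α α' β β' γ σ u =
        Complex.Gamma γ * msmGammaRatio α α' β β' γ σ := by
  have hγn : ∀ n : ℕ, 0 < (γ + n).re := fun n => by
    simp only [Complex.add_re, Complex.natCast_re]
    positivity
  obtain ⟨C, hC, hc⟩ := exists_norm_appellF3PfaffCoeff_le α α' β β' hγ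
  obtain ⟨B, hB, hb⟩ := exists_norm_beta_add_le hγ hP
  have key := integrable_and_hasSum_of_summable_integral_norm
    (μ := volume.restrict (Set.Ioo (0 : ℝ) 1))
    (F := fun (k : ℕ × ℕ) (u : ℝ) => appellF3PfaffCoeff α α' β β' γ k *
      ((u : ℂ) ^ (γ + (k.1 + k.2 : ℕ) - 1) * (1 - (u : ℂ)) ^ (σ + α + α' - γ - 1)))
    (f := msmUnitKernel α α' β β' γ σ)
    (fun k => (integrableOn_beta (hγn _) hP).const_mul _) ?_ ?_
  · refine ⟨key.1, hasSum_gauss_gauss hγ hβ hQ ?_⟩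
    have h := key.2
    simp only [integral_const_mul, setIntegral_beta (hγn _) hP] at h
    exact h
  -- With this `H`, the condition `A < H` is `hQ` and `A + E < H` is `hβ`.
  · have hs := (summable_rpow_prod (E := (α + β - γ + β').re) (A := α'.re)
      (H := β'.re + (σ + α + α' - γ).re) hα' (by
        simp only [Complex.sub_re, Complex.add_re] at *; linarith) (by
        simp only [Complex.sub_re, Complex.add_re] at *; linarith)).mul_left (C * B)
    refine Summable.of_nonneg_of_le (fun k => integral_nonneg fun _ => norm_nonneg _)
      (fun ⟨i, j⟩ => ?_) hs
    simp only [norm_mul (appellF3PfaffCoeff α α' β β' γ _)]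
    rw [integral_const_mul, setIntegral_norm_beta (hγn _) hP]
    have hb' := hb (i + j)
    have hij : (0 : ℝ) < (i : ℝ) + j + 1 := by positivity
    rw [neg_add, Real.rpow_add hij]
    simp only [Complex.add_re, Complex.natCast_re, Complex.ofReal_add, Complex.ofReal_natCast] at hb' ⊢
    have hc' := hc (i, j)
    simp only [Nat.cast_add] at hb' hc' ⊢
    calc _ ≤ _ := mul_le_mul hc' hb' (norm_nonneg _) (by positivity)
      _ = _ := by simp only [Complex.add_re]; ring
  · filter_upwards [ae_restrict_mem measurableSet_Ioo] with u hu
    exact msmUnitKernel_eq_tsum α α' β β' σ hγ hu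

/-- The factor `-y = u / (1 - u)` of the contiguous relation is the change of the two powers when
`γ` becomes `γ + 1`. -/
theorem msmUnitKernel_contiguous (α α' β β' : ℂ) {γ : ℂ} (σ : ℂ) (hγ : 0 < γ.re) {u : ℝ}
    (hu : u ∈ Set.Ioo (0 : ℝ) 1) :
    msmUnitKernel α α' β β' γ σ u = msmUnitKernel α (α' + 1) β β' γ σ u +
      β' / γ * msmUnitKernel α (α' + 1) β (β' + 1) (γ + 1) σ u := by
  have h1 : 0 < 1 - u := by linarith [hu.2]
  have hu0 : (u : ℂ) ≠ 0 := by exact_mod_cast hu.1.ne'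
  have hu1 : (1 : ℂ) - u ≠ 0 := by exact_mod_cast h1.ne'
  have hx : ‖(u : ℂ)‖ < 1 := by rw [Complex.norm_real, Real.norm_of_nonneg hu.1.le]; exact hu.2
  have hy : (-((u : ℂ) / (1 - u))).re < 1 / 2 := by
    rw [show -((u : ℂ) / (1 - u)) = ((-(u / (1 - u)) : ℝ) : ℂ) by push_cast; rfl, Complex.ofReal_re]
    have : 0 < u / (1 - u) := div_pos hu.1 h1
    linarith
  simp only [msmUnitKernel]
  rw [appellF3_contiguous α α' β β' hγ hx hy, show γ + 1 - 1 = γ - 1 + 1 by ring,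
    Complex.cpow_add _ _ hu0, Complex.cpow_one,
    show σ + α - γ - 1 = σ + α - (γ + 1) - 1 + 1 by ring, Complex.cpow_add _ _ hu1,
    Complex.cpow_one]
  field_simp
  ring

/-- With `P = σ + α + α' - γ` and `R = P + β'`, the two terms on the right combine through `(P + β')
/ Γ(R + 1) = 1 / Γ(R)`. -/
theorem msmGammaRatio_contiguous {α α' β β' γ σ : ℂ} (hγ : γ ≠ 0)
    (hP : σ + α + α' - γ ≠ 0) :
    Complex.Gamma γ * msmGammaRatio α α' β β' γ σ =
      Complex.Gamma γ * msmGammaRatio α (α' + 1) β β' γ σ +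
      β' / γ * (Complex.Gamma (γ + 1) * msmGammaRatio α (α' + 1) β (β' + 1) (γ + 1) σ) := by
  have hR := Complex.one_div_Gamma_eq_self_mul_one_div_Gamma_add_one (σ + α + α' + β' - γ)
  simp only [msmGammaRatio]
  rw [Complex.Gamma_add_one _ hγ, show σ + α + (α' + 1) - γ = σ + α + α' - γ + 1 by ring,
    Complex.Gamma_add_one _ hP, show σ + α + (α' + 1) - (γ + 1) = σ + α + α' - γ by ring,
    show σ + α + (β' + 1) - (γ + 1) = σ + α + β' - γ by ring,
    show σ + α + (α' + 1) + (β' + 1) - (γ + 1) = σ + α + α' + β' - γ + 1 by ring,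
    show σ + α + (α' + 1) + β' - γ = σ + α + α' + β' - γ + 1 by ring]
  simp only [div_eq_mul_inv, mul_inv]
  rw [hR]
  field_simp
  ring

/-- The Mellin transform of the Marichev-Saigo-Maeda kernel. -/
theorem msmUnitKernel_integral {α β σ : ℂ} (hβ : 0 < (σ - β).re) (α' β' γ : ℂ) (hγ : 0 < γ.re)
    (hP : 0 < (σ + α + α' - γ).re) (hQ : 0 < (σ + α + β' - γ).re) :
    IntegrableOn (msmUnitKernel α α' β β' γ σ) (Set.Ioo 0 1) ∧
      ∫ u in Set.Ioo (0 : ℝ) 1, msmUnitKernel α α' β β' γ σ u =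
        Complex.Gamma γ * msmGammaRatio α α' β β' γ σ := by
  -- Raising `α'` may also raise `β'` and `γ`, hence the generalisation. If all three rise, the
  -- quantities in `hP` and `hQ` stay the same.
  induction α' using Complex.induction_of_re_pos generalizing β' γ with
  | h0 α' h => exact msmUnitKernel_integral_of_re_pos hγ h hβ hP hQ
  | h1 α' ih =>
    have i1 := ih β' γ hγ (by
      simp only [Complex.add_re, Complex.sub_re, Complex.one_re] at hP ⊢; linarith) hQ
    have i2 := ih (β' + 1) (γ + 1) (by
      simp only [Complex.add_re, Complex.one_re]; linarith) (by
      simp only [Complex.add_re, Complex.sub_re, Complex.one_re] at hP ⊢; linarith) (by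
      simp only [Complex.add_re, Complex.sub_re, Complex.one_re] at hQ ⊢; linarith)
    have he : Set.EqOn (fun u => msmUnitKernel α (α' + 1) β β' γ σ u +
        β' / γ * msmUnitKernel α (α' + 1) β (β' + 1) (γ + 1) σ u)
        (msmUnitKernel α α' β β' γ σ) (Set.Ioo 0 1) :=
      fun u hu => (msmUnitKernel_contiguous α α' β β' σ hγ hu).symm
    refine ⟨IntegrableOn.congr_fun (i1.1.add (i2.1.const_mul (β' / γ))) he measurableSet_Ioo, ?_⟩
    rw [← setIntegral_congr_fun measurableSet_Ioo he, integral_add i1.1 (i2.1.const_mul _),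
      integral_const_mul, i1.2, i2.2, ← msmGammaRatio_contiguous]
    · rintro rfl; simp at hγ
    · intro h; simp [h] at hP

/-! ### The fractional integral of a power, by `t = x / (1 - u)` -/

theorem image_div_one_sub {x : ℝ} (hx : 0 < x) :
    (fun u : ℝ => x / (1 - u)) '' Set.Ioo 0 1 = Set.Ioi x := by
  ext t
  simp only [Set.mem_image, Set.mem_Ioo, Set.mem_Ioi]
  constructor
  · rintro ⟨u, ⟨h0, h1⟩, rfl⟩
    rw [lt_div_iff₀ (by linarith)]
    nlinarith
  · intro ht
    have ht0 : 0 < t := hx.trans ht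
    refine ⟨1 - x / t, ⟨?_, ?_⟩, ?_⟩
    · rw [sub_pos, div_lt_one ht0]; exact ht
    · have := div_pos hx ht0; linarith
    · rw [sub_sub_cancel]; field_simp

theorem injOn_div_one_sub {x : ℝ} (hx : 0 < x) :
    Set.InjOn (fun u : ℝ => x / (1 - u)) (Set.Ioo 0 1) := by
  intro u hu v hv h
  have h1 : 1 - u ≠ 0 := by linarith [hu.2]
  have h2 : 1 - v ≠ 0 := by linarith [hv.2]
  simp only at h
  rw [div_eq_div_iff h1 h2] at h
  have := mul_left_cancel₀ hx.ne' h
  linarith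

theorem hasDerivWithinAt_div_one_sub (x : ℝ) {u : ℝ} (hu : u ∈ Set.Ioo (0 : ℝ) 1) :
    HasDerivWithinAt (fun u : ℝ => x / (1 - u)) (x / (1 - u) ^ 2) (Set.Ioo 0 1) u := by
  have h1 : 1 - u ≠ 0 := by linarith [hu.2]
  have := ((hasDerivAt_const u x).div ((hasDerivAt_id u).const_sub 1) h1).hasDerivWithinAt
    (s := Set.Ioo 0 1)
  refine this.congr_deriv ?_
  simp

theorem msmRightIntegrand_cpow_comp (α α' β β' γ σ : ℂ) {x u : ℝ} (hx : 0 < x)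
    (hu : u ∈ Set.Ioo (0 : ℝ) 1) :
    |x / (1 - u) ^ 2| • msmRightIntegrand α α' β β' γ (fun t => (t : ℂ) ^ (-σ)) x (x / (1 - u)) =
      (x : ℂ) ^ (γ - α - σ) * msmUnitKernel α α' β β' γ σ u := by
  have h1 : 0 < 1 - u := by linarith [hu.2]
  have hx0 : (x : ℂ) ≠ 0 := by exact_mod_cast hx.ne'
  have hv0 : ((1 - u : ℝ) : ℂ) ≠ 0 := by exact_mod_cast h1.ne'
  have e1 : x / (1 - u) - x = x * u * (1 - u)⁻¹ := by field_simp; ring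
  have e2 : 1 - x / (x / (1 - u)) = u := by field_simp; ring
  have e3 : 1 - x / (1 - u) / x = -(u / (1 - u)) := by field_simp; ring
  have hinv : ∀ w : ℂ, (((1 - u)⁻¹ : ℝ) : ℂ) ^ w = ((1 - u : ℝ) : ℂ) ^ (-w) := by
    intro w
    rw [Complex.ofReal_inv, Complex.inv_cpow, Complex.cpow_neg]
    rw [Complex.arg_ofReal_of_nonneg h1.le]
    exact Real.pi_pos.ne
  have hdiv : ∀ w : ℂ, ((x / (1 - u) : ℝ) : ℂ) ^ w = (x : ℂ) ^ w * ((1 - u : ℝ) : ℂ) ^ (-w) := by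
    intro w
    rw [div_eq_mul_inv, Complex.ofReal_mul, Complex.mul_cpow_ofReal_nonneg hx.le
      (inv_nonneg.2 h1.le), hinv]
  rw [abs_of_pos (by positivity), msmRightIntegrand, msmUnitKernel, e2, e3, e1,
    show (1 : ℂ) - u = ((1 - u : ℝ) : ℂ) by push_cast; rfl, hdiv, hdiv, Complex.real_smul,
    Complex.ofReal_mul, Complex.mul_cpow_ofReal_nonneg (mul_pos hx hu.1).le (inv_nonneg.2 h1.le),
    Complex.ofReal_mul, Complex.mul_cpow_ofReal_nonneg hx.le hu.1.le, hinv]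
  have p1 : (x : ℂ) ^ (γ - α - σ) =
      (x : ℂ) * ((x : ℂ) ^ (γ - 1) * (x : ℂ) ^ (-α) * (x : ℂ) ^ (-σ)) := by
    rw [← Complex.cpow_add _ _ hx0, ← Complex.cpow_add _ _ hx0,
      show γ - α - σ = 1 + (γ - 1 + -α + -σ) by ring, Complex.cpow_add _ _ hx0, Complex.cpow_one]
  have p2 : ((1 - u : ℝ) : ℂ) ^ (σ + α - γ - 1) = (((1 - u : ℝ) : ℂ) ^ 2)⁻¹ *
      (((1 - u : ℝ) : ℂ) ^ (-(γ - 1)) * ((1 - u : ℝ) : ℂ) ^ (- -α) *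
        ((1 - u : ℝ) : ℂ) ^ (- -σ)) := by
    rw [← Complex.cpow_add _ _ hv0, ← Complex.cpow_add _ _ hv0, ← Complex.cpow_natCast,
      ← Complex.cpow_neg, ← Complex.cpow_add _ _ hv0]
    congr 1
    push_cast
    ring
  rw [p1, p2]
  push_cast
  ring

/-- The right-sided Marichev-Saigo-Maeda integral of a power function. -/
theorem msmRightIntegrand_cpow_integral {α α' β β' γ σ : ℂ} (hγ : 0 < γ.re)
    (hβ : 0 < (σ - β).re) (hP : 0 < (σ + α + α' - γ).re) (hQ : 0 < (σ + α + β' - γ).re)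
    {x : ℝ} (hx : 0 < x) :
    IntegrableOn (msmRightIntegrand α α' β β' γ (fun t => (t : ℂ) ^ (-σ)) x) (Set.Ioi x) ∧
      ∫ t in Set.Ioi x, msmRightIntegrand α α' β β' γ (fun t => (t : ℂ) ^ (-σ)) x t =
        (x : ℂ) ^ (γ - α - σ) * (Complex.Gamma γ * msmGammaRatio α α' β β' γ σ) := by
  have key := msmUnitKernel_integral hβ α' β' γ hγ hP hQ
  have he : Set.EqOn (fun u => (x : ℂ) ^ (γ - α - σ) * msmUnitKernel α α' β β' γ σ u)
      (fun u => |x / (1 - u) ^ 2| •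
        msmRightIntegrand α α' β β' γ (fun t => (t : ℂ) ^ (-σ)) x (x / (1 - u))) (Set.Ioo 0 1) :=
    fun u hu => (msmRightIntegrand_cpow_comp α α' β β' γ σ hx hu).symm
  rw [← image_div_one_sub hx, integrableOn_image_iff_integrableOn_abs_deriv_smul measurableSet_Ioo
    (fun u hu => hasDerivWithinAt_div_one_sub x hu) (injOn_div_one_sub hx),
    integral_image_eq_integral_abs_deriv_smul measurableSet_Ioo
    (fun u hu => hasDerivWithinAt_div_one_sub x hu) (injOn_div_one_sub hx)]
  refine ⟨IntegrableOn.congr_fun (key.1.const_mul _) he measurableSet_Ioo, ?_⟩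
  rw [← setIntegral_congr_fun measurableSet_Ioo he, integral_const_mul, key.2]

/-! ### Enlarged Mellin-Barnes kernel, phases and Fubini -/

theorem iKernel_append {m n p q : ℕ} (hm : m ≤ q) (u : Fin p → GammaTriple)
    (l : Fin q → GammaTriple) (v w : Fin 3 → GammaTriple) (s : ℂ) :
    iKernel m (n + 3) (Fin.append v u) (Fin.append l w) s = iKernel m n u l s *
      ((∏ i, gammaPow (v i).κ (1 - (v i).a - (v i).A * s)) /
        ∏ j, gammaPow (w j).κ (1 - (w j).a - (w j).A * s)) := by
  -- As `m ≤ q`, the appended lower triples fall into the denominator; the upper ones come first,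
  -- among the `n + 3` numerator indices.
  have h1 : ∀ j : Fin 3, ¬ q + j.val < m := fun j => by omega
  have h2 : ∀ j : Fin 3, m ≤ q + j.val := fun j => by omega
  have h3 : ∀ i : Fin 3, i.val < n + 3 := fun i => by omega
  have h4 : ∀ i : Fin 3, ¬ n + 3 ≤ i.val := fun i => by omega
  have h5 : ∀ i : Fin p, 3 + i.val < n + 3 ↔ i.val < n := fun i => by omega
  have h6 : ∀ i : Fin p, n + 3 ≤ 3 + i.val ↔ n ≤ i.val := fun i => by omega
  simp only [iKernel, Finset.prod_filter, Fin.prod_univ_add, Fin.append_left, Fin.append_right,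
    Fin.val_castAdd, Fin.val_natAdd, h1, h2, h3, h4, h5, h6, if_true, if_false,
    Finset.prod_const_one, mul_one, one_mul]
  rw [div_mul_div_comm]
  congr 1 <;> ring

/-- A positive factor leaves the argument of `a` unchanged, so principal powers split; on the
contour the positive factor contributes a pure phase. -/
theorem cpow_mul_rpow_neg {a : ℂ} (ha : a ≠ 0) {t : ℝ} (ht : 0 < t) (μ y : ℝ) :
    (a * ((t ^ (-μ) : ℝ) : ℂ)) ^ (-(Complex.I * y)) =
      a ^ (-(Complex.I * y)) * Complex.exp (((μ * Real.log t * y : ℝ) : ℂ) * Complex.I) := by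
  have h := Real.rpow_pos_of_pos ht (-μ)
  have h0 : ((t ^ (-μ) : ℝ) : ℂ) ≠ 0 := by exact_mod_cast h.ne'
  rw [Complex.cpow_def_of_ne_zero (mul_ne_zero ha h0), Complex.log_mul_ofReal _ h _ ha,
    Real.log_rpow ht, Complex.cpow_def_of_ne_zero ha, ← Complex.exp_add]
  congr 1
  push_cast
  ring

/-- The same phase as in `cpow_mul_rpow_neg`: it turns `t^{-ρ}` into the power `t^{-σ}` with `σ = ρ
- μ s`. -/
theorem cpow_neg_sub {t : ℝ} (ht : 0 < t) (ρ : ℂ) (μ y : ℝ) :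
    (t : ℂ) ^ (-(ρ - μ * (Complex.I * y))) =
      (t : ℂ) ^ (-ρ) * Complex.exp (((μ * Real.log t * y : ℝ) : ℂ) * Complex.I) := by
  have h0 : (t : ℂ) ≠ 0 := by exact_mod_cast ht.ne'
  rw [Complex.cpow_def_of_ne_zero h0, Complex.cpow_def_of_ne_zero h0, ← Complex.exp_add,
    ← Complex.ofReal_log ht.le]
  congr 1
  push_cast
  ring

theorem measurable_exp_log_mul_I (μ : ℝ) : Measurable fun z : ℝ × ℝ =>
    Complex.exp (((μ * Real.log z.1 * z.2 : ℝ) : ℂ) * Complex.I) := by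
  have h : Measurable fun z : ℝ × ℝ => μ * Real.log z.1 * z.2 :=
    ((Real.measurable_log.comp measurable_fst).const_mul μ).mul measurable_snd
  exact Complex.measurable_exp.comp ((Complex.measurable_ofReal.comp h).mul_const Complex.I)

theorem MeasureTheory.Integrable.mul_prod_exp_log_mul_I {A B : ℝ → ℂ} {ν : Measure ℝ} [SFinite ν]
    (hB : Integrable B ν) (hA : Integrable A) (μ : ℝ) :
    Integrable (fun z : ℝ × ℝ => B z.1 * A z.2 *
      Complex.exp (((μ * Real.log z.1 * z.2 : ℝ) : ℂ) * Complex.I)) (ν.prod volume) := by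
  refine Integrable.mul_bdd (c := 1) (f := fun z : ℝ × ℝ => B z.1 * A z.2) (hB.mul_prod hA)
    (measurable_exp_log_mul_I μ).aestronglyMeasurable (Eventually.of_forall fun z => ?_)
  rw [Complex.norm_exp_ofReal_mul_I]

theorem IFunctionAdmissible.mul_rpow {m n p q : ℕ} {u : Fin p → GammaTriple}
    {l : Fin q → GammaTriple} {a : ℂ} (h : IFunctionAdmissible m n u l a) (μ : ℝ) {t : ℝ}
    (ht : 0 < t) : IFunctionAdmissible m n u l (a * ((t ^ (-μ) : ℝ) : ℂ)) where
  m_le := h.m_le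
  n_le := h.n_le
  upper_pos := h.upper_pos
  lower_pos := h.lower_pos
  left_of_contour := h.left_of_contour
  right_of_contour := h.right_of_contour
  arg_ne_zero := mul_ne_zero h.arg_ne_zero
    (by exact_mod_cast (Real.rpow_pos_of_pos ht (-μ)).ne')
  converges := by
    simp only [cpow_mul_rpow_neg h.arg_ne_zero ht, ← mul_assoc]
    refine h.converges.mul_bdd (c := 1) (by fun_prop) (Eventually.of_forall fun y => ?_)
    rw [Complex.norm_exp_ofReal_mul_I]

theorem theorem3p2 {p q : ℕ} (m n : ℕ) (u : Fin p → GammaTriple) (l : Fin q → GammaTriple)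
    (α α' β β' γ ρ a : ℂ) (μ : ℝ) (hγ : 0 < γ.re) (hμ : 0 < μ)
    (hρ : max β.re (max (-α - α' + γ).re (-α - β' + γ).re) < ρ.re)
    (hI : IFunctionAdmissible m n u l a) (x : ℝ) (hx : 0 < x) :
    let f : ℝ → ℂ := fun t =>
      (t : ℂ) ^ (-ρ) * iFunction m n u l (a * ((t ^ (-μ) : ℝ) : ℂ))
    let u' : Fin (3 + p) → GammaTriple :=
      Fin.append ![⟨1 + β - ρ, μ, 1⟩, ⟨1 - α - α' + γ - ρ, μ, 1⟩, ⟨1 - α - β' + γ - ρ, μ, 1⟩] u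
    let l' : Fin (q + 3) → GammaTriple :=
      Fin.append l ![⟨1 - ρ, μ, 1⟩, ⟨1 - α + β - ρ, μ, 1⟩, ⟨1 - α - α' - β' + γ - ρ, μ, 1⟩]
    (∀ t : ℝ, 0 < t → IFunctionAdmissible m n u l (a * ((t ^ (-μ) : ℝ) : ℂ))) ∧
    MeasureTheory.IntegrableOn (msmRightIntegrand α α' β β' γ f x) (Set.Ioi x) ∧
    IFunctionAdmissible m (n + 3) u' l' (a * ((x ^ (-μ) : ℝ) : ℂ)) ∧
    msmRight α α' β β' γ f x =
      (x : ℂ) ^ (-α - α' + γ - ρ) *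
        iFunction m (n + 3) u' l' (a * ((x ^ (-μ) : ℝ) : ℂ)) := by
  intro f u' l'
  obtain ⟨hρβ, hρ⟩ := max_lt_iff.1 hρ
  obtain ⟨hρP, hρQ⟩ := max_lt_iff.1 hρ
  have hσ : ∀ y : ℝ, (ρ - μ * (Complex.I * y)).re = ρ.re := fun y => by simp
  have hβ : ∀ y : ℝ, 0 < (ρ - μ * (Complex.I * y) - β).re := fun y => by
    rw [Complex.sub_re, hσ]; linarith
  have hP : ∀ y : ℝ, 0 < (ρ - μ * (Complex.I * y) + α + α' - γ).re := fun y => by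
    rw [Complex.sub_re, Complex.add_re, Complex.add_re, hσ]
    simp only [Complex.add_re, Complex.sub_re, Complex.neg_re] at hρP
    linarith
  have hQ : ∀ y : ℝ, 0 < (ρ - μ * (Complex.I * y) + α + β' - γ).re := fun y => by
    rw [Complex.sub_re, Complex.add_re, Complex.add_re, hσ]
    simp only [Complex.add_re, Complex.sub_re, Complex.neg_re] at hρQ
    linarith
  have hx0 : (x : ℂ) ≠ 0 := by exact_mod_cast hx.ne'
  have hG : Complex.Gamma γ ≠ 0 := Complex.Gamma_ne_zero_of_re_pos hγ
  set A : ℝ → ℂ := fun y => iKernel m n u l (Complex.I * y) * a ^ (-(Complex.I * y)) with hA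
  set B : ℝ → ℂ := msmRightIntegrand α α' β β' γ (fun t => (t : ℂ) ^ (-ρ)) x with hB
  set φ : ℝ → ℝ → ℂ := fun t y => Complex.exp (((μ * Real.log t * y : ℝ) : ℂ) * Complex.I) with hφ
  -- The new triples have exponent `1`, so they contribute ordinary Gamma functions, which form the
  -- ratio at `σ = ρ - μ s`.
  have hI' : ∀ y : ℝ, iKernel m (n + 3) u' l' (Complex.I * y) =
      iKernel m n u l (Complex.I * y) * msmGammaRatio α α' β β' γ (ρ - μ * (Complex.I * y)) := by
    intro y
    rw [iKernel_append hI.m_le]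
    congr 1
    simp only [Fin.prod_univ_three, gammaPow_one, msmGammaRatio, Matrix.cons_val_zero,
      Matrix.cons_val_one, Matrix.cons_val]
    congr 1 <;> ring_nf
  have hpow : ∀ y : ℝ, IntegrableOn (fun t => B t * φ t y) (Set.Ioi x) ∧
      ∫ t in Set.Ioi x, B t * φ t y = (x : ℂ) ^ (γ - α - ρ) * φ x y *
        (Complex.Gamma γ * msmGammaRatio α α' β β' γ (ρ - μ * (Complex.I * y))) := by
    intro y
    have h := msmRightIntegrand_cpow_integral hγ (hβ y) (hP y) (hQ y) hx
    have he : Set.EqOn (msmRightIntegrand α α' β β' γ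
        (fun t => (t : ℂ) ^ (-(ρ - μ * (Complex.I * y)))) x) (fun t => B t * φ t y) (Set.Ioi x) := by
      intro t ht
      simp only [hB, hφ, msmRightIntegrand]
      rw [cpow_neg_sub (hx.trans ht)]
      ring
    have hxp : (x : ℂ) ^ (γ - α - (ρ - μ * (Complex.I * y))) = (x : ℂ) ^ (γ - α - ρ) * φ x y := by
      rw [sub_eq_add_neg _ (ρ - _), Complex.cpow_add _ _ hx0, cpow_neg_sub hx,
        sub_eq_add_neg _ ρ, Complex.cpow_add _ _ hx0]
      simp only [hφ]
      ring
    rw [hxp] at h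
    exact ⟨h.1.congr_fun he measurableSet_Ioi, by
      rw [← setIntegral_congr_fun measurableSet_Ioi he]; exact h.2⟩
  -- At `y = 0` the phase is `1`.
  have hBint : IntegrableOn B (Set.Ioi x) := by
    simpa [hφ] using (hpow 0).1
  have hΦ : Integrable (Function.uncurry fun t y => B t * A y * φ t y)
      ((volume.restrict (Set.Ioi x)).prod volume) :=
    Integrable.mul_prod_exp_log_mul_I hBint hI.converges μ
  have hif : ∀ t : ℝ, 0 < t → iFunction m n u l (a * ((t ^ (-μ) : ℝ) : ℂ)) =
      1 / (2 * Real.pi * Complex.I) * Complex.I * ∫ y, A y * φ t y := by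
    intro t ht
    simp only [iFunction]
    rw [integral_mul_const]
    simp only [cpow_mul_rpow_neg hI.arg_ne_zero ht, hA, hφ, mul_assoc]
    ring
  have hint : Set.EqOn (fun t => 1 / (2 * Real.pi * Complex.I) * Complex.I *
      ∫ y, B t * A y * φ t y) (msmRightIntegrand α α' β β' γ f x) (Set.Ioi x) := by
    intro t ht
    have h : ∫ y, B t * A y * φ t y = B t * ∫ y, A y * φ t y := by
      simp only [mul_assoc, integral_const_mul]
    simp only [h, f, msmRightIntegrand]
    rw [hif t (hx.trans ht)]
    simp only [hB, msmRightIntegrand]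
    ring
  have hright : ∀ y : ℝ, ∫ t in Set.Ioi x, B t * A y * φ t y =
      (x : ℂ) ^ (γ - α - ρ) * Complex.Gamma γ * (iKernel m (n + 3) u' l' (Complex.I * y) *
        (a * ((x ^ (-μ) : ℝ) : ℂ)) ^ (-(Complex.I * y))) := by
    intro y
    simp only [mul_right_comm (B _) (A _)]
    rw [integral_mul_const, (hpow y).2, hI', cpow_mul_rpow_neg hI.arg_ne_zero hx]
    simp only [hA, hφ]
    ring
  have hc : (x : ℂ) ^ (γ - α - ρ) * Complex.Gamma γ ≠ 0 :=
    mul_ne_zero (by simp [Complex.cpow_eq_zero_iff, hx0]) hG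
  refine ⟨fun t ht => hI.mul_rpow μ ht, ?_, ?_, ?_⟩
  · exact IntegrableOn.congr_fun (hΦ.integral_prod_left.const_mul _) hint measurableSet_Ioi
  · have hadm := hI.mul_rpow μ hx
    refine ⟨hI.m_le.trans (by omega), by have := hI.n_le; omega, ?_, ?_, ?_, ?_,
      hadm.arg_ne_zero, ?_⟩
    · intro i
      refine Fin.addCases (fun i => ?_) (fun i => ?_) i
      · simp only [u', Fin.append_left]
        fin_cases i <;> simp [hμ]
      · simp only [u', Fin.append_right]
        exact hI.upper_pos i
    · intro j
      refine Fin.addCases (fun j => ?_) (fun j => ?_) j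
      · simp only [l', Fin.append_left]
        exact hI.lower_pos j
      · simp only [l', Fin.append_right]
        fin_cases j <;> simp [hμ]
    · intro j
      refine Fin.addCases (fun j => ?_) (fun j => ?_) j
      · simp only [l', Fin.append_left, Fin.val_castAdd]
        exact hI.left_of_contour j
      · intro hj
        have := hI.m_le
        simp only [Fin.val_natAdd] at hj
        omega
    · intro i
      refine Fin.addCases (fun i => ?_) (fun i => ?_) i
      · intro _ k s hs
        simp only [u', Fin.append_left] at hs
        have hk : (0 : ℝ) ≤ k := Nat.cast_nonneg k
        have hs' := congrArg Complex.re hs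
        -- In real parts the pole equation says that `μ * s.re` is `k` plus one of the three gaps
        -- `Re (ρ - β)`, `Re (ρ + α + α' - γ)`, `Re (ρ + α + β' - γ)`, all positive.
        refine pos_of_mul_pos_right (a := μ) ?_ hμ.le
        simp only [Complex.add_re, Complex.sub_re, Complex.neg_re] at hρP hρQ
        fin_cases i <;> simp at hs' <;> linarith
      · intro hi
        simp only [u', Fin.append_right]
        simp only [Fin.val_natAdd] at hi
        exact hI.right_of_contour i (by omega)
    -- Fubini also gives absolute convergence on the right: integrating out `t` leaves a nonzero
    -- constant times the new contour integrand.
    · have h := hΦ.integral_prod_right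
      simp only [Function.uncurry, hright] at h
      refine (h.const_mul ((x : ℂ) ^ (γ - α - ρ) * Complex.Gamma γ)⁻¹).congr
        (Eventually.of_forall fun y => ?_)
      simp only
      rw [inv_mul_cancel_left₀ hc]
  · rw [msmRight, ← setIntegral_congr_fun measurableSet_Ioi hint, integral_const_mul,
      integral_integral_swap hΦ]
    simp only [hright]
    rw [integral_const_mul, iFunction, integral_mul_const]
    have hxp : (x : ℂ) ^ (-α - α' + γ - ρ) = (x : ℂ) ^ (-α') * (x : ℂ) ^ (γ - α - ρ) := by
      rw [← Complex.cpow_add _ _ hx0]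
      ring_nf
    rw [hxp]
    field_simp
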